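/- **Theorem (Green function comparison).** A *generalized Wigner matrix* is an $N\times N$ hermitian (possibly real symmetric) random matrix $H=(h_{ij})$ such that $\{h_{ij}: i\le j\}$ are independent, $\mathbb E h_{ij}=0$, $\sum_j\mathbb E|h_{ij}|^2=1$ for every $i$, and $0<C_{inf}\le N\,\mathbb E|h_{ij}|^2\le C_{sup}<\infty$ for all $i,j$, with $C_{inf},C_{sup}$ independent of $N$. Let $H^{(v)},H^{(w)}$ be two generalized Wigner matrices with entries $N^{-1/2}v_{ij}$ and $N^{-1/2}w_{ij}$, defined on one probability space so that the pairs $(v_{ij},w_{ij})$, $i\le j$, are independent, and with $$\mathbb P(|v_{ij}|\ge x)\le C e^{-x^\vartheta},\qquad \mathbb P(|w_{ij}|\ge x)\le C e^{-x^\vartheta}\qquad(x>0)$$ for some $C,\vartheta>0$. Let $\gamma(N)=N(N+1)/2$, fix a bijection $\phi:\{(i,j):1\le i\le j\le N\}\to\{1,\dots,\gamma(N)\}$, and for $0\le\gamma\le\gamma(N)$ let $H_\gamma$ be the hermitian matrix whose $(i,j)$ entry, $i\le j$, is $N^{-1/2}w_{ij}$ if $\phi(i,j)\le\gamma$ and $N^{-1/2}v_{ij}$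 otherwise; thus $H_0=H^{(v)}$ and $H_{\gamma(N)}=H^{(w)}$. Let $\kappa>0$ and suppose that for every $\tau>0$ and every $y\ge N^{-1+\tau}$ $$\mathbb P\Big(\max_{0\le\gamma\le\gamma(N)}\max_{1\le l\le N}\max_{|E|\le2-\kappa}\Big|\Big(\frac1{H_\gamma-E-iy}\Big)_{ll}\Big|\le N^{2\tau}\Big)\ge1-C'N^{-c'\log\log N},$$ where $C'$ and $c'>0$ depend only on $\tau,\kappa$. Assume further that, for all $i,j$, $$\mathbb E\,\overline v_{ij}^{\,s}v_{ij}^{u}=\mathbb E\,\overline w_{ij}^{\,s}w_{ij}^{u}\quad(0\le s+u\le3),\qquad \big|\mathbb E\,\overline v_{ij}^{\,s}v_{ij}^{4-s}-\mathbb E\,\overline w_{ij}^{\,s}w_{ij}^{4-s}\big|\le N^{-\delta}\quad(0\le s\le4)$$ for some $\delta>0$. Let $\varepsilon>0$ and $N^{-1-\varepsilon}\le\eta\le N^{-1}$. Let $k_1,\dots,k_n$ be positive integers and $z^m_j=E^m_j\pm i\eta$ ($1\le m\le n$, $1\le j\le k_m$) with $|E^m_j|\le2-2\kappa$ and arbitrary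 signs. Let $F:\mathbb C^n\to\mathbb C$ (which may depend on $N$) be of class $C^5$ in the $2n$ real coordinates, and let $\partial^\alpha$ denote partial derivatives in these coordinates. Let $C_0,\varepsilon_0>0$ and suppose that for $1\le|\alpha|\le5$: 1. for every $\varepsilon'\in(0,\varepsilon_0]$ there is $N_1(\varepsilon')$ such that $|\partial^\alpha F(x)|\le N^{C_0\varepsilon'}$ whenever $\max_m|x_m|\le N^{\varepsilon'}$ and $N\ge N_1(\varepsilon')$; 2. $|\partial^\alpha F(x)|\le N^{C_0}$ whenever $|x_m|\le N^{\max(2,\,1+k_m\varepsilon)}$ for all $m$ (that is, $\max_m|x_m|\le N^2$ if $\varepsilon\le 1/\max_m k_m$). With $G^{(v)}(z)=(H^{(v)}-z)^{-1}$ and $G^{(w)}(z)=(H^{(w)}-z)^{-1}$, put $$\Delta=\Big|\mathbb E F\Big(\frac1{N^{k_1}}\mathrm{Tr}\prod_{j=1}^{k_1}G^{(v)}(z^1_j),\dots,\frac1{N^{k_n}}\mathrm{Tr}\prod_{j=1}^{k_n}G^{(v)}(z^n_j)\Big)-\mathbb E F\big(G^{(v)}\to G^{(w)}\big)\Big|,$$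 where in the second term $G^{(v)}$ is replaced by $G^{(w)}$ and nothing else changes. Then there is a constant $C_1>0$ depending only on $\vartheta$, $\sum_m k_m$ and $C_0$ such that, if $C_1\varepsilon\le\varepsilon_0$, $$\Delta\le C_1N^{-1/2+C_1\varepsilon}+C_1N^{-\delta+C_1\varepsilon}$$ for all sufficiently large $N$. For arbitrary $\varepsilon>0$ the same bound holds for all sufficiently large $N$ with $C_1$ replaced by a constant $C_2>0$ that depends only on $\vartheta$, $\sum_m k_m$, $C_0$ and $\varepsilon_0$. Here "sufficiently large" depends only on $C,\vartheta,C_{inf},C_{sup},\kappa,\delta,\varepsilon,\varepsilon_0,C_0,\sum_m k_m$ and on the functions $\tau\mapsto(C',c')$ and $\varepsilon'\mapsto N_1(\varepsilon')$. -/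

import Mathlib

open MeasureTheory ProbabilityTheory

noncomputable section

/-- The index set `{(i, j) : i ≤ j}` of the independent entries of an `N × N` hermitian matrix. -/
abbrev UpperIdx (N : ℕ) : Type := {p : Fin N × Fin N // p.1 ≤ p.2}

/-- The independent entry that determines the `(i, j)` entry: `(i, j)` if `i ≤ j`,
and `(j, i)` otherwise. -/
def upperIdx {N : ℕ} (i j : Fin N) : UpperIdx N := ⟨(min i j, max i j), min_le_max⟩

/-- Generalized Wigner matrix: a hermitian random matrix (real symmetric ones included) whose
entries are centered, whose variances sum to one in each row and are comparable to `1 / N`,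
and whose entries on and above the diagonal are independent. -/
structure IsGeneralizedWigner {Ω : Type*} [MeasurableSpace Ω] (μ : Measure Ω) {N : ℕ}
    (Cinf Csup : ℝ) (H : Ω → Matrix (Fin N) (Fin N) ℂ) : Prop where
  measurable : ∀ i j, Measurable fun ω => H ω i j
  hermitian : ∀ ω, (H ω).IsHermitian
  memLp_two : ∀ i j, MemLp (fun ω => H ω i j) 2 μ
  centered : ∀ i j, ∫ ω, H ω i j ∂μ = 0
  sum_variance : ∀ i, ∑ j, ∫ ω, ‖H ω i j‖ ^ 2 ∂μ = 1
  le_variance : ∀ i j, Cinf ≤ N * ∫ ω, ‖H ω i j‖ ^ 2 ∂μ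
  variance_le : ∀ i j, N * ∫ ω, ‖H ω i j‖ ^ 2 ∂μ ≤ Csup
  indep : iIndepFun (fun (p : UpperIdx N) ω => H ω p.1.1 p.1.2) μ

/-- Uniform subexponential decay of the entries, `ℙ(|v_ij| ≥ x) ≤ C exp (-x ^ ϑ)`. -/
def SubexpDecay {Ω : Type*} [MeasurableSpace Ω] (μ : Measure Ω) {N : ℕ} (C ϑ : ℝ)
    (v : Ω → Matrix (Fin N) (Fin N) ℂ) : Prop :=
  ∀ i j, ∀ x : ℝ, 0 < x → μ.real {ω | x ≤ ‖v ω i j‖} ≤ C * Real.exp (-x ^ ϑ)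

/-- The matrix `H` with entries `h_ij = N ^ (-1/2) v_ij`. -/
def normalized {N : ℕ} (v : Matrix (Fin N) (Fin N) ℂ) : Matrix (Fin N) (Fin N) ℂ :=
  (Real.sqrt N)⁻¹ • v

/-- The mixed moment `𝔼 (conj v_ij) ^ s * v_ij ^ u`. -/
def entryMoment {Ω : Type*} [MeasurableSpace Ω] (μ : Measure Ω) {N : ℕ}
    (v : Ω → Matrix (Fin N) (Fin N) ℂ) (i j : Fin N) (s u : ℕ) : ℂ :=
  ∫ ω, (starRingEnd ℂ (v ω i j)) ^ s * (v ω i j) ^ u ∂μ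

/-- The interpolating matrix `H_γ`: the entries `(i, j)` with `φ(i, j) ≤ γ` (and their mirror
images) are those of `B`, all others are those of `A`. -/
def interpolate {N : ℕ} (φ : UpperIdx N ≃ Finset.Icc 1 (N * (N + 1) / 2)) (γ : ℕ)
    (A B : Matrix (Fin N) (Fin N) ℂ) : Matrix (Fin N) (Fin N) ℂ :=
  Matrix.of fun i j => if (φ (upperIdx i j) : ℕ) ≤ γ then B i j else A i j

/-- The resolvent `(H - z)⁻¹`. -/
def green {N : ℕ} (H : Matrix (Fin N) (Fin N) ℂ) (z : ℂ) : Matrix (Fin N) (Fin N) ℂ :=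
  (H - z • (1 : Matrix (Fin N) (Fin N) ℂ))⁻¹

/-- The vector of the numbers `N ^ (-k_m) Tr (G(z^m_1) ⋯ G(z^m_{k_m}))`, `m = 1, …, n`. -/
def greenTraces {N n : ℕ} {k : Fin n → ℕ} (z : (m : Fin n) → Fin (k m) → ℂ)
    (H : Matrix (Fin N) (Fin N) ℂ) : Fin n → ℂ :=
  fun m => ((N : ℂ) ^ k m)⁻¹ * (List.ofFn fun j => green H (z m j)).prod.trace

/-- The `2 n` real coordinate directions of `ℂ ^ n`. -/
def coordDir {n : ℕ} (d : Fin n × Bool) : Fin n → ℂ :=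
  Pi.single d.1 (if d.2 then Complex.I else 1)

/-- All partial derivatives of `F` of orders `1, …, 5` with respect to the `2 n` real
coordinates of `ℂ ^ n` are bounded by `B` at the point `x`. -/
def PartialsBoundedAt {n : ℕ} (F : (Fin n → ℂ) → ℂ) (x : Fin n → ℂ) (B : ℝ) : Prop :=
  ∀ a : ℕ, 1 ≤ a → a ≤ 5 → ∀ d : Fin a → Fin n × Bool,
    ‖iteratedFDeriv ℝ a F x fun l => coordDir (d l)‖ ≤ B

end

/-!
The observable changes little when one entry of the matrix is replaced by another one with nearly
the same moments, and the `N (N + 1) / 2` replacements are made one after the other.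

Fix a step and let `Q` be the matrix with the entry in question, and its mirror image, set to zero.
The observable is a function `f` of that entry `x`, which is independent of `Q`. Conditionally on
`Q`, expand `f` at `0` to fifth order (`norm_integral_sub_integral_le`): the terms of order up to
three agree for both laws, the one of order four carries a factor `N ^ (-δ)`. Since the derivative
of a resolvent entry in `x` is `N ^ (-1/2)` times a quadratic expression in resolvent entries, a
bound `Γ` for all resolvent entries gives derivatives of order `a` of size
`N ^ (-a / 2) Γ ^ (a (K + 1))` times the derivatives of the test function, where `K = ∑ k_m`
(`norm_iteratedFDeriv_comp_greenTraces_le`). Hence with `Γ = N ^ (O(ε))` each replacement costs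
`N ^ (-2 - δ + O(ε)) + N ^ (-5/2 + O(ε))`, and summation over the `O(N ^ 2)` entries gives the claim
(`norm_integral_interpolate_succ_sub_le`, `replacement_sum_le`).

The bound on `Γ` below the scale `1 / N`, including the entries off the diagonal, comes from the
a priori bound on the diagonal above that scale. The resolvent identity in the spectral parameter,
the Cauchy-Schwarz inequality and the Ward identity give
`|G_kl(E + i y)| ≤ |G_kl(E + i y')| + (y' / y) max_m |G_mm(E + i y')|` for `y ≤ y'`
(`norm_green_apply_le_add`). A ladder of `O(1 / ε)` heights from order one down to `η`, with
consecutive ratios at most `N ^ (2 ε)`, therefore yields `Γ = N ^ (5 ε)` outside an event of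
probability `O(N ^ (-c log log N))` (`measureReal_largeGreen_le`). As the resolvent entries at most
double when a single small entry is changed (`norm_green_add_entryPert_le`), the bound passes from
one interpolating matrix to `Q` and to all matrices met in the Taylor expansion. On the exceptional
event, and where the entry exceeds `N ^ ε`, the deterministic bound `|G_kl| ≤ 1 / η` and the
polynomial bounds on the test function suffice, because these events have a probability smaller
than any power of `N`.

When `ε ≥ 1 / 24`, or when `C₁ ε > ε₀`, the oscillation of the observable is at most a fixed power
of `N` (`norm_comp_greenTraces_sub_le`), and this power is absorbed by the factor `N ^ (C ε)`.
-/

namespace GreenComparison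

/-! ### Resolvents of hermitian matrices -/

section Resolvent

open scoped Matrix.Norms.L2Operator

variable {N : ℕ} {H H' : Matrix (Fin N) (Fin N) ℂ} {z z' : ℂ}

lemma isUnit_sub_smul_one (hH : H.IsHermitian) (hz : z.im ≠ 0) :
    IsUnit (H - z • (1 : Matrix (Fin N) (Fin N) ℂ)) := by
  have h : z ∉ spectrum ℂ H := fun hmem =>
    hz (IsSelfAdjoint.im_eq_zero_of_mem_spectrum (a := H) hH hmem)
  rw [spectrum.notMem_iff, Algebra.algebraMap_eq_smul_one] at h
  rw [← neg_sub]
  exact h.neg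

lemma mul_green (hH : H.IsHermitian) (hz : z.im ≠ 0) :
    (H - z • (1 : Matrix (Fin N) (Fin N) ℂ)) * green H z = 1 :=
  Matrix.mul_nonsing_inv _ ((Matrix.isUnit_iff_isUnit_det _).1 (isUnit_sub_smul_one hH hz))

lemma green_mul (hH : H.IsHermitian) (hz : z.im ≠ 0) :
    green H z * (H - z • (1 : Matrix (Fin N) (Fin N) ℂ)) = 1 :=
  Matrix.nonsing_inv_mul _ ((Matrix.isUnit_iff_isUnit_det _).1 (isUnit_sub_smul_one hH hz))

/-- The resolvent identity in the spectral parameter. -/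
lemma green_sub_green (hH : H.IsHermitian) (hz : z.im ≠ 0) (hz' : z'.im ≠ 0) :
    green H z - green H z' = (z - z') • (green H z * green H z') := by
  have e : (z - z') • (1 : Matrix (Fin N) (Fin N) ℂ) =
      (H - z' • (1 : Matrix (Fin N) (Fin N) ℂ)) - (H - z • (1 : Matrix (Fin N) (Fin N) ℂ)) := by
    rw [sub_smul]; abel
  calc green H z - green H z'
      = green H z * ((H - z' • (1 : Matrix (Fin N) (Fin N) ℂ)) * green H z') -
        (green H z * (H - z • (1 : Matrix (Fin N) (Fin N) ℂ))) * green H z' := by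
        rw [mul_green hH hz', green_mul hH hz, mul_one, one_mul]
    _ = green H z * ((z - z') • (1 : Matrix (Fin N) (Fin N) ℂ)) * green H z' := by
        rw [e]; noncomm_ring
    _ = _ := by simp

/-- The resolvent identity in the matrix. -/
lemma green_eq_add (hH : H.IsHermitian) (hH' : H'.IsHermitian) (hz : z.im ≠ 0) :
    green H' z = green H z + green H z * (H - H') * green H' z := by
  have e : H - H' = (H - z • (1 : Matrix (Fin N) (Fin N) ℂ)) -
      (H' - z • (1 : Matrix (Fin N) (Fin N) ℂ)) := by abel
  rw [e, mul_sub, sub_mul, green_mul hH hz, mul_assoc, mul_green hH' hz]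
  simp

lemma conjTranspose_green (hH : H.IsHermitian) :
    (green H z).conjTranspose = green H (starRingEnd ℂ z) := by
  rw [green, Matrix.conjTranspose_nonsing_inv, green]
  simp [Matrix.conjTranspose_sub, hH.eq]

lemma norm_green_conj (hH : H.IsHermitian) (k l : Fin N) :
    ‖green H (starRingEnd ℂ z) k l‖ = ‖green H z l k‖ := by
  rw [← conjTranspose_green hH, Matrix.conjTranspose_apply, norm_star]

lemma green_mul_conjTranspose (hH : H.IsHermitian) (hz : z.im ≠ 0) :
    (2 * z.im * Complex.I) • (green H z * (green H z).conjTranspose) =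
      green H z - (green H z).conjTranspose := by
  rw [conjTranspose_green hH, green_sub_green hH hz (by simpa using hz)]
  congr 1
  apply Complex.ext <;> simp
  ring

lemma conjTranspose_mul_green (hH : H.IsHermitian) (hz : z.im ≠ 0) :
    (2 * z.im * Complex.I) • ((green H z).conjTranspose * green H z) =
      green H z - (green H z).conjTranspose := by
  rw [conjTranspose_green hH, ← neg_sub, green_sub_green hH (by simpa using hz) hz, ← neg_smul]
  congr 1
  apply Complex.ext <;> simp
  ring

lemma norm_green_le (hH : H.IsHermitian) (hz : z.im ≠ 0) : ‖green H z‖ ≤ |z.im|⁻¹ := by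
  have h1 := congrArg norm (conjTranspose_mul_green hH hz)
  rw [norm_smul, Matrix.l2_opNorm_conjTranspose_mul_self] at h1
  have h2 : ‖green H z - (green H z).conjTranspose‖ ≤ ‖green H z‖ + ‖green H z‖ := by
    refine (norm_sub_le _ _).trans ?_
    rw [Matrix.l2_opNorm_conjTranspose]
  have h3 : ‖(2 * z.im * Complex.I : ℂ)‖ = 2 * |z.im| := by simp
  rw [h3] at h1
  have hp : 0 < |z.im| := abs_pos.2 hz
  rcases (norm_nonneg (green H z)).eq_or_lt with h0 | h0
  · rw [← h0]; positivity
  · rw [← one_div, le_div_iff₀ hp]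
    nlinarith

lemma norm_entry_le (A : Matrix (Fin N) (Fin N) ℂ) (k l : Fin N) : ‖A k l‖ ≤ ‖A‖ := by
  have h := A.l2_opNorm_mulVec (EuclideanSpace.single l (1 : ℂ))
  rw [show ‖EuclideanSpace.single l (1 : ℂ)‖ = 1 by simp, mul_one] at h
  refine le_trans ?_ h
  have h2 := PiLp.norm_apply_le ((EuclideanSpace.equiv (Fin N) ℂ).symm
    (A.mulVec (EuclideanSpace.single l (1 : ℂ)).ofLp)) k
  simpa [Matrix.mulVec_single] using h2

lemma norm_green_apply_le (hH : H.IsHermitian) (hz : z.im ≠ 0) (k l : Fin N) :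
    ‖green H z k l‖ ≤ |z.im|⁻¹ :=
  (norm_entry_le _ k l).trans (norm_green_le hH hz)

lemma norm_list_prod_green_le (hH : H.IsHermitian) {η : ℝ} (hη : 0 < η) :
    ∀ (k : ℕ) (z : Fin k → ℂ), (∀ j, |(z j).im| = η) →
      ‖(List.ofFn fun j => green H (z j)).prod‖ ≤ (η⁻¹) ^ k
  | 0, z, _ => by
      rcases subsingleton_or_nontrivial (Matrix (Fin N) (Fin N) ℂ) with h | h
      · simp [Subsingleton.elim (1 : Matrix (Fin N) (Fin N) ℂ) 0]
      · simp
  | k + 1, z, hz => by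
      rw [List.ofFn_succ, List.prod_cons, pow_succ']
      refine (norm_mul_le _ _).trans ?_
      have h0 : (z 0).im ≠ 0 := fun h => by have := hz 0; simp [h] at this; linarith
      gcongr
      · rw [← hz 0]; exact norm_green_le hH h0
      · exact norm_list_prod_green_le hH hη k (fun j => z j.succ) fun j => hz _

lemma norm_trace_list_prod_green_le (hH : H.IsHermitian) {η : ℝ} (hη : 0 < η) {k : ℕ}
    (z : Fin k → ℂ) (hz : ∀ j, |(z j).im| = η) :
    ‖(List.ofFn fun j => green H (z j)).prod.trace‖ ≤ N * (η⁻¹) ^ k := by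
  rw [Matrix.trace]
  refine (norm_sum_le _ _).trans ?_
  calc ∑ i, ‖(List.ofFn fun j => green H (z j)).prod.diag i‖ ≤ ∑ _i : Fin N, (η⁻¹) ^ k :=
        Finset.sum_le_sum fun i _ =>
          (norm_entry_le _ i i).trans (norm_list_prod_green_le hH hη k z hz)
    _ = _ := by simp

/-- The Ward identity for the rows of the resolvent, as an inequality. -/
lemma sum_norm_sq_row_le (hH : H.IsHermitian) (hz : z.im ≠ 0) (k : Fin N) :
    ∑ m, ‖green H z k m‖ ^ 2 ≤ ‖green H z k k‖ / |z.im| := by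
  have h1 := congrArg norm (congrFun (congrFun (green_mul_conjTranspose hH hz) k) k)
  have e : (green H z * (green H z).conjTranspose) k k = ((∑ m, ‖green H z k m‖ ^ 2 : ℝ) : ℂ) := by
    rw [Matrix.mul_apply]
    push_cast
    refine Finset.sum_congr rfl fun m _ => ?_
    rw [Matrix.conjTranspose_apply]
    exact Complex.mul_conj' _
  have h3 : ‖(2 * z.im * Complex.I : ℂ)‖ = 2 * |z.im| := by simp
  rw [Matrix.smul_apply, e, smul_eq_mul, norm_mul, h3, Complex.norm_real,
    Real.norm_of_nonneg (by positivity), Matrix.sub_apply, Matrix.conjTranspose_apply] at h1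
  have h2 := norm_sub_le (green H z k k) (star (green H z k k))
  rw [norm_star] at h2
  rw [le_div_iff₀ (abs_pos.2 hz)]
  linarith

/-- The Ward identity for the columns of the resolvent, as an inequality. -/
lemma sum_norm_sq_col_le (hH : H.IsHermitian) (hz : z.im ≠ 0) (k : Fin N) :
    ∑ m, ‖green H z m k‖ ^ 2 ≤ ‖green H z k k‖ / |z.im| := by
  have h := sum_norm_sq_row_le hH (z := starRingEnd ℂ z) (by simpa using hz) k
  simpa [norm_green_conj hH] using h

lemma sum_norm_sq_mul_le (A B : Matrix (Fin N) (Fin N) ℂ) (l : Fin N) :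
    ∑ m, ‖(A * B) m l‖ ^ 2 ≤ ‖A‖ ^ 2 * ∑ m, ‖B m l‖ ^ 2 := by
  have h := A.l2_opNorm_mulVec (WithLp.toLp 2 fun m => B m l)
  have h' := pow_le_pow_left₀ (norm_nonneg _) h 2
  rw [mul_pow, EuclideanSpace.norm_sq_eq, EuclideanSpace.norm_sq_eq] at h'
  exact h'

/-- The norm of a column of the resolvent grows at most by the factor `y' / y` when the distance
to the real axis decreases from `y'` to `y`. -/
lemma sum_norm_sq_col_green_le (hH : H.IsHermitian) {x y y' : ℝ} (hy : 0 < y) (hyy' : y ≤ y')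
    (l : Fin N) :
    ∑ m, ‖green H (x + y * Complex.I) m l‖ ^ 2 ≤
      (y' / y) ^ 2 * ∑ m, ‖green H (x + y' * Complex.I) m l‖ ^ 2 := by
  have hi : ∀ t : ℝ, ((x : ℂ) + t * Complex.I).im = t := fun t => by simp
  have hz : ((x : ℂ) + y * Complex.I).im ≠ 0 := by rw [hi]; exact hy.ne'
  have hz' : ((x : ℂ) + y' * Complex.I).im ≠ 0 := by rw [hi]; linarith
  set G := green H (x + y * Complex.I)
  set G' := green H (x + y' * Complex.I)
  set c : ℂ := (x + y * Complex.I) - (x + y' * Complex.I)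
  have hc : ‖c‖ = y' - y := by
    have : c = ((y - y' : ℝ) : ℂ) * Complex.I := by simp only [c]; push_cast; ring
    rw [this, norm_mul, Complex.norm_I, mul_one, Complex.norm_real, Real.norm_eq_abs, abs_sub_comm,
      abs_of_nonneg (by linarith)]
  have e : G = (1 + c • G) * G' := by
    have := green_sub_green hH hz hz'
    rw [add_mul, one_mul, smul_mul_assoc, ← this]; abel
  have hn : ‖1 + c • G‖ ≤ y' / y := by
    refine (norm_add_le _ _).trans ?_
    rw [norm_smul, hc]
    have h1 : ‖(1 : Matrix (Fin N) (Fin N) ℂ)‖ ≤ 1 := by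
      rcases subsingleton_or_nontrivial (Matrix (Fin N) (Fin N) ℂ) with h | h
      · simp [Subsingleton.elim (1 : Matrix (Fin N) (Fin N) ℂ) 0]
      · simp
    have h2 : ‖G‖ ≤ y⁻¹ := by
      have := norm_green_le hH hz
      rwa [hi, abs_of_pos hy] at this
    calc _ ≤ 1 + (y' - y) * y⁻¹ := by gcongr
      _ = y' / y := by field_simp; ring
  calc ∑ m, ‖G m l‖ ^ 2 = ∑ m, ‖((1 + c • G) * G') m l‖ ^ 2 := by rw [← e]
    _ ≤ _ := sum_norm_sq_mul_le _ _ _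
    _ ≤ _ := by gcongr

/-- A bound `B` on the diagonal of the resolvent at height `y'` controls all entries at the lower
height `y`, up to the entries at height `y'`. -/
lemma norm_green_apply_le_add (hH : H.IsHermitian) {x y y' B : ℝ} (hy : 0 < y) (hyy' : y ≤ y')
    (hB : ∀ l, ‖green H (x + y' * Complex.I) l l‖ ≤ B) (k l : Fin N) :
    ‖green H (x + y * Complex.I) k l‖ ≤
      ‖green H (x + y' * Complex.I) k l‖ + y' / y * B := by
  have hi : ∀ t : ℝ, ((x : ℂ) + t * Complex.I).im = t := fun t => by simp
  have hy' : 0 < y' := hy.trans_le hyy'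
  have hz : ((x : ℂ) + y * Complex.I).im ≠ 0 := by rw [hi]; exact hy.ne'
  have hz' : ((x : ℂ) + y' * Complex.I).im ≠ 0 := by rw [hi]; linarith
  set G := green H (x + y * Complex.I) with hG
  set G' := green H (x + y' * Complex.I) with hG'
  have hB0 : 0 ≤ B := (norm_nonneg _).trans (hB k)
  set c : ℂ := (x + y' * Complex.I) - (x + y * Complex.I)
  have hc : ‖c‖ = y' - y := by
    have : c = ((y' - y : ℝ) : ℂ) * Complex.I := by simp only [c]; push_cast; ring
    rw [this, norm_mul, Complex.norm_I, mul_one, Complex.norm_real,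
      Real.norm_of_nonneg (by linarith)]
  have e : G = G' - c • (G' * G) := by
    rw [← green_sub_green hH hz' hz]; abel
  have hrow : ∑ m, ‖G' k m‖ ^ 2 ≤ B / y' := by
    refine (sum_norm_sq_row_le hH hz' k).trans ?_
    rw [hi, abs_of_pos hy']
    gcongr
    exact hB k
  have hcol : ∑ m, ‖G m l‖ ^ 2 ≤ (y' / y) ^ 2 * (B / y') := by
    refine (sum_norm_sq_col_green_le hH hy hyy' l).trans ?_
    gcongr
    refine (sum_norm_sq_col_le hH hz' l).trans ?_
    rw [hi, abs_of_pos hy']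
    gcongr
    exact hB l
  have hprod : ‖(G' * G) k l‖ ≤ B / y := by
    rw [Matrix.mul_apply]
    refine (norm_sum_le _ _).trans ?_
    simp_rw [norm_mul]
    refine (Real.sum_mul_le_sqrt_mul_sqrt _ _ _).trans ?_
    calc _ ≤ √(B / y') * √((y' / y) ^ 2 * (B / y')) := by gcongr
      _ = B / y := by
        rw [Real.sqrt_mul (by positivity), Real.sqrt_sq (by positivity)]
        have := Real.mul_self_sqrt (show 0 ≤ B / y' by positivity)
        calc _ = (y' / y) * (√(B / y') * √(B / y')) := by ring
          _ = _ := by rw [this]; field_simp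
  calc ‖G k l‖ = ‖G' k l - c * (G' * G) k l‖ := by conv_lhs => rw [e]; simp
    _ ≤ ‖G' k l‖ + ‖c * (G' * G) k l‖ := norm_sub_le _ _
    _ ≤ _ := by
      rw [norm_mul, hc]
      have : (y' - y) * ‖(G' * G) k l‖ ≤ y' * (B / y) := by gcongr; linarith
      calc _ ≤ ‖G' k l‖ + y' * (B / y) := by linarith
        _ = _ := by ring

/-- Bounds on the diagonal of the resolvent along a ladder of heights `y 1 ≤ ⋯ ≤ y J`, whose
consecutive ratios are at most `q` and whose last member is at least one, bound every entry of
the resolvent at the height `y 0`. -/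
lemma norm_green_apply_le_of_chain (hH : H.IsHermitian) {x B q : ℝ} {J : ℕ} (y : ℕ → ℝ)
    (hy : 0 < y 0) (hmono : Monotone y) (hq : ∀ j < J, y (j + 1) ≤ q * y j) (hJ : 1 ≤ y J)
    (hB : ∀ j, 1 ≤ j → j ≤ J → ∀ l, ‖green H (x + y j * Complex.I) l l‖ ≤ B)
    (hB0 : 0 ≤ B) (k l : Fin N) :
    ‖green H (x + y 0 * Complex.I) k l‖ ≤ 1 + J * (q * B) := by
  have hpos : ∀ j, 0 < y j := fun j => hy.trans_le (hmono (Nat.zero_le j))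
  have key : ∀ i, i ≤ J → ‖green H (x + y (J - i) * Complex.I) k l‖ ≤ 1 + i * (q * B) := by
    intro i
    induction i with
    | zero =>
      intro _
      have h := norm_green_apply_le hH (z := x + y J * Complex.I) (by simp [(hpos J).ne']) k l
      simp only [Complex.add_im, Complex.ofReal_im, Complex.mul_im, Complex.ofReal_re,
        Complex.I_im, mul_one, Complex.I_re, mul_zero, add_zero, zero_add] at h
      rw [abs_of_pos (hpos J)] at h
      simpa using h.trans (inv_le_one_of_one_le₀ hJ)
    | succ i ih =>
      intro hi
      have h1 := norm_green_apply_le_add hH (hpos (J - (i + 1))) (hmono (Nat.sub_le_sub_left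
        (Nat.le_succ i) J)) (hB (J - i) (by omega) (by omega)) k l
      have h2 := ih (by omega)
      have h3 : y (J - i) / y (J - (i + 1)) ≤ q := by
        rw [div_le_iff₀ (hpos _)]
        have := hq (J - (i + 1)) (by omega)
        rwa [show J - (i + 1) + 1 = J - i by omega] at this
      have h4 : y (J - i) / y (J - (i + 1)) * B ≤ q * B := by gcongr
      push_cast
      linarith
  simpa using key J le_rfl

end Resolvent

/-! ### Perturbing one entry -/

/-- The hermitian matrix whose only non-zero entries are `a` at `(i, j)` and its conjugate at
`(j, i)`; on the diagonal the two add up to `2 * re a`. -/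
def entryPert {N : ℕ} (i j : Fin N) (a : ℂ) : Matrix (Fin N) (Fin N) ℂ :=
  Matrix.single i j a + Matrix.single j i (starRingEnd ℂ a)

section Perturbation

variable {N : ℕ} {i j : Fin N}

lemma isHermitian_entryPert (a : ℂ) : (entryPert i j a).IsHermitian := by
  rw [Matrix.IsHermitian, entryPert, Matrix.conjTranspose_add, Matrix.conjTranspose_single,
    Matrix.conjTranspose_single, add_comm]
  simp

lemma mul_entryPert_mul_apply (A B : Matrix (Fin N) (Fin N) ℂ) (a : ℂ) (k l : Fin N) :
    (A * entryPert i j a * B) k l =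
      A k i * B j l * a + A k j * B i l * starRingEnd ℂ a := by
  rw [entryPert, mul_add, add_mul, Matrix.add_apply]
  congr 1 <;>
  · rw [Matrix.mul_assoc, Matrix.mul_apply, Finset.sum_eq_single_of_mem _ (Finset.mem_univ _)]
    · rw [Matrix.single_mul_apply_same]; ring
    · intro m _ hm
      rw [Matrix.single_mul_apply_of_ne _ _ _ _ _ hm]; ring

/-- Resolvent entries at most double under a perturbation of a single entry that is small compared
to the inverse of their size. -/
lemma norm_green_add_entryPert_le {H : Matrix (Fin N) (Fin N) ℂ} {z a : ℂ} {Γ : ℝ}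
    (hH : H.IsHermitian) (hz : z.im ≠ 0) (hΓ : ∀ k l, ‖green H z k l‖ ≤ Γ)
    (ha : 4 * ‖a‖ * Γ ≤ 1) (k l : Fin N) :
    ‖green (H + entryPert i j a) z k l‖ ≤ 2 * Γ := by
  have hH' := hH.add (isHermitian_entryPert (i := i) (j := j) a)
  -- at the largest entry `M`, the resolvent identity reads `M ≤ Γ + 2 * Γ * ‖a‖ * M ≤ Γ + M / 2`
  obtain ⟨p, hp⟩ := @Finite.exists_max (Fin N × Fin N) ℝ _ ⟨(k, l)⟩ _
    fun p => ‖green (H + entryPert i j a) z p.1 p.2‖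
  have hΓ0 : 0 ≤ Γ := (norm_nonneg _).trans (hΓ k l)
  have e := congrFun (congrFun (green_eq_add hH hH' hz) p.1) p.2
  rw [show H - (H + entryPert i j a) = -entryPert i j a by abel, mul_neg, neg_mul,
    Matrix.add_apply, Matrix.neg_apply, mul_entryPert_mul_apply] at e
  set M := ‖green (H + entryPert i j a) z p.1 p.2‖
  have hM0 : 0 ≤ M := norm_nonneg _
  have h1 : ∀ q r s, ‖green H z p.1 q * green (H + entryPert i j a) z r s‖ ≤ Γ * M := by
    intro q r s
    rw [norm_mul]
    exact mul_le_mul (hΓ _ _) (hp (r, s)) (norm_nonneg _) hΓ0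
  have h2 : M ≤ Γ + (Γ * M * ‖a‖ + Γ * M * ‖a‖) := by
    refine (congrArg norm e).trans_le ?_
    refine (norm_add_le _ _).trans (add_le_add (hΓ _ _) ?_)
    rw [norm_neg]
    refine (norm_add_le _ _).trans (add_le_add ?_ ?_)
    · rw [norm_mul]; gcongr; exact h1 _ _ _
    · rw [norm_mul, RCLike.norm_conj]; gcongr; exact h1 _ _ _
  have h3 : 4 * ‖a‖ * Γ * M ≤ 1 * M := by gcongr
  exact (hp (k, l)).trans (by linarith)

end Perturbation

/-! ### Derivatives of the resolvent in one entry -/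

section Deriv

open scoped Matrix.Norms.L2Operator

variable {N : ℕ} {i j : Fin N} {Q : Matrix (Fin N) (Fin N) ℂ} {z : ℂ} (L : ℂ →L[ℝ] ℂ)

variable (i j) in
/-- `entryPert` as a real-linear map. -/
noncomputable def entryPertCLM : ℂ →L[ℝ] Matrix (Fin N) (Fin N) ℂ :=
  LinearMap.toContinuousLinearMap
    { toFun := entryPert i j
      map_add' := fun a b => by
        simp only [entryPert, map_add, Matrix.single_add]; abel
      map_smul' := fun r a => by
        simp [entryPert, Matrix.smul_single] }

lemma entryPertCLM_apply (a : ℂ) : entryPertCLM i j a = entryPert i j a := rfl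

/-- Evaluation of a matrix at an entry. -/
noncomputable def entryCLM (k l : Fin N) : Matrix (Fin N) (Fin N) ℂ →L[ℝ] ℂ :=
  LinearMap.toContinuousLinearMap
    { toFun := fun A => A k l
      map_add' := fun _ _ => rfl
      map_smul' := fun _ _ => rfl }

lemma green_eq_ringInverse (H : Matrix (Fin N) (Fin N) ℂ) :
    green H z = Ring.inverse (H - z • (1 : Matrix (Fin N) (Fin N) ℂ)) :=
  Matrix.nonsing_inv_eq_ringInverse _

lemma contDiff_green_apply (hQ : Q.IsHermitian) (hz : z.im ≠ 0) (k l : Fin N) {n : WithTop ℕ∞} :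
    ContDiff ℝ n fun x => green (Q + entryPert i j (L x)) z k l := by
  suffices h : ContDiff ℝ n fun x => green (Q + entryPert i j (L x)) z from
    (entryCLM k l).contDiff.comp h
  refine contDiff_iff_contDiffAt.2 fun x => ?_
  simp_rw [green_eq_ringInverse]
  have hu := isUnit_sub_smul_one (hQ.add (isHermitian_entryPert (i := i) (j := j) (L x))) hz
  have h1 := contDiffAt_ringInverse ℝ (n := n) hu.unit
  refine ContDiffAt.comp (g := Ring.inverse)
    (f := fun x => Q + entryPert i j (L x) - z • (1 : Matrix (Fin N) (Fin N) ℂ)) x h1 ?_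
  have : ContDiff ℝ n fun x => Q + entryPertCLM i j (L x) - z • (1 : Matrix (Fin N) (Fin N) ℂ) := by
    fun_prop
  exact this.contDiffAt

lemma hasFDerivAt_green_apply (hQ : Q.IsHermitian) (hz : z.im ≠ 0) (k l : Fin N) (x : ℂ) :
    HasFDerivAt (fun x => green (Q + entryPert i j (L x)) z k l)
      (-((green (Q + entryPert i j (L x)) z k i * green (Q + entryPert i j (L x)) z j l) • L +
        (green (Q + entryPert i j (L x)) z k j * green (Q + entryPert i j (L x)) z i l) •
          ((Complex.conjCLE : ℂ →L[ℝ] ℂ).comp L))) x := by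
  have hu := isUnit_sub_smul_one (hQ.add (isHermitian_entryPert (i := i) (j := j) (L x))) hz
  have h1 := hasFDerivAt_ringInverse (𝕜 := ℝ) hu.unit
  have h2 : HasFDerivAt (fun x => Q + entryPertCLM i j (L x) -
      z • (1 : Matrix (Fin N) (Fin N) ℂ)) ((entryPertCLM i j).comp L) x :=
    ((((entryPertCLM i j).comp L).hasFDerivAt).const_add Q).sub_const _
  have h3 := (entryCLM k l).hasFDerivAt.comp x (HasFDerivAt.comp x h1 h2)
  have e : (fun x => green (Q + entryPert i j (L x)) z k l) = (entryCLM k l) ∘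
      (Ring.inverse ∘ fun x => Q + entryPertCLM i j (L x) -
        z • (1 : Matrix (Fin N) (Fin N) ℂ)) := by
    funext y
    rw [green_eq_ringInverse]; rfl
  rw [e]
  refine h3.congr_fderiv ?_
  ext1 h
  have hinv : (↑(hu.unit)⁻¹ : Matrix (Fin N) (Fin N) ℂ) = green (Q + entryPert i j (L x)) z := by
    rw [green_eq_ringInverse, ← Ring.inverse_unit]; rfl
  rw [hinv]
  have := mul_entryPert_mul_apply (i := i) (j := j) (green (Q + entryPert i j (L x)) z)
    (green (Q + entryPert i j (L x)) z) (L h) k l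
  simp only [ContinuousLinearMap.comp_apply, _root_.neg_apply,
    _root_.add_apply, _root_.smul_apply, smul_eq_mul,
    ContinuousLinearMap.mulLeftRight_apply, map_neg, neg_inj]
  exact this

end Deriv

/-! ### Bounds for iterated derivatives -/

section Bounds

/-- The weights `m ! * D ^ m` are stable under products: if the iterated derivatives of two
functions have sizes `A * m ! * D ^ m` and `A' * m ! * D' ^ m`, then those of the product have
size `A * A' * m ! * (D + D') ^ m`. -/
lemma norm_iteratedFDeriv_mul_le_factorial {f g : ℂ → ℂ} {x : ℂ} {A A' D D' : ℝ} {n : ℕ}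
    {r : WithTop ℕ∞}
    (hf : ContDiff ℝ r f) (hg : ContDiff ℝ r g) (hnr : n ≤ r) (hA' : 0 ≤ A')
    (hA : 0 ≤ A) (hD : 0 ≤ D) (hD' : 0 ≤ D')
    (hfb : ∀ m ≤ n, ‖iteratedFDeriv ℝ m f x‖ ≤ A * (m.factorial * D ^ m))
    (hgb : ∀ m ≤ n, ‖iteratedFDeriv ℝ m g x‖ ≤ A' * (m.factorial * D' ^ m)) :
    ‖iteratedFDeriv ℝ n (fun y => f y * g y) x‖ ≤ A * A' * (n.factorial * (D + D') ^ n) := by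
  refine (norm_iteratedFDeriv_mul_le hf hg x hnr).trans ?_
  rw [add_pow, Finset.mul_sum, Finset.mul_sum]
  refine Finset.sum_le_sum fun m hm => ?_
  have hmn : m ≤ n := Nat.lt_succ_iff.1 (Finset.mem_range.1 hm)
  have h1 : (1 : ℝ) ≤ n.choose m := by exact_mod_cast Nat.choose_pos hmn
  have h2 : (n.choose m : ℝ) * m.factorial * (n - m).factorial = n.factorial := by
    exact_mod_cast Nat.choose_mul_factorial_mul_factorial hmn
  calc (n.choose m : ℝ) * ‖iteratedFDeriv ℝ m f x‖ * ‖iteratedFDeriv ℝ (n - m) g x‖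
      ≤ n.choose m * (A * (m.factorial * D ^ m)) *
        (A' * ((n - m).factorial * D' ^ (n - m))) := by
        gcongr
        · exact hfb m hmn
        · exact hgb _ (Nat.sub_le _ _)
    _ = A * A' * ((n.choose m * m.factorial * (n - m).factorial) * (D ^ m * D' ^ (n - m))) := by
        ring
    _ = A * A' * (n.factorial * (D ^ m * D' ^ (n - m) * 1)) := by rw [h2, mul_one]
    _ ≤ _ := by gcongr

lemma norm_iteratedFDeriv_smul_const_le {W : Type*} [NormedAddCommGroup W] [NormedSpace ℂ W]
    {f : ℂ → ℂ} {n : ℕ} (hf : ContDiff ℝ n f) (c : W) (x : ℂ) :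
    ‖iteratedFDeriv ℝ n (fun y => f y • c) x‖ ≤ ‖c‖ * ‖iteratedFDeriv ℝ n f x‖ := by
  refine (ContinuousLinearMap.norm_iteratedFDeriv_comp_left
    ((ContinuousLinearMap.toSpanSingleton ℂ c).restrictScalars ℝ) hf.contDiffAt le_rfl).trans ?_
  gcongr
  exact ContinuousLinearMap.opNorm_le_bound _ (norm_nonneg _) fun y => by
    simp [norm_smul, mul_comm]

variable {N : ℕ} {i j : Fin N} {Q : Matrix (Fin N) (Fin N) ℂ} {z : ℂ} {L : ℂ →L[ℝ] ℂ} {b Γ : ℝ}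

/-- Since the derivative of a resolvent entry is a quadratic expression in resolvent entries, a
bound on the entries at one point bounds all their iterated derivatives there. -/
lemma norm_iteratedFDeriv_green_apply_le (hQ : Q.IsHermitian) (hz : z.im ≠ 0) (hL : ‖L‖ ≤ b)
    {x : ℂ} (hΓ : ∀ k l, ‖green (Q + entryPert i j (L x)) z k l‖ ≤ Γ) (n : ℕ) (k l : Fin N) :
    ‖iteratedFDeriv ℝ n (fun x => green (Q + entryPert i j (L x)) z k l) x‖ ≤
      Γ * (n.factorial * (2 * b * Γ) ^ n) := by
  have hΓ0 : 0 ≤ Γ := (norm_nonneg _).trans (hΓ k l)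
  have hb0 : 0 ≤ b := (norm_nonneg _).trans hL
  induction n using Nat.strong_induction_on generalizing k l with
  | _ n ih =>
  obtain _ | n := n
  · rw [norm_iteratedFDeriv_zero]
    simpa using hΓ k l
  have hsm : ∀ k l, ContDiff ℝ n fun x => green (Q + entryPert i j (L x)) z k l :=
    fun k l => contDiff_green_apply L hQ hz k l
  have e : fderiv ℝ (fun x => green (Q + entryPert i j (L x)) z k l) = -fun x =>
      (green (Q + entryPert i j (L x)) z k i * green (Q + entryPert i j (L x)) z j l) • L +
        (green (Q + entryPert i j (L x)) z k j * green (Q + entryPert i j (L x)) z i l) •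
          ((Complex.conjCLE : ℂ →L[ℝ] ℂ).comp L) :=
    funext fun x => (hasFDerivAt_green_apply L hQ hz k l x).fderiv
  have hmul : ∀ k l p q, ‖iteratedFDeriv ℝ n (fun x => green (Q + entryPert i j (L x)) z k p *
      green (Q + entryPert i j (L x)) z q l) x‖ ≤
      Γ * Γ * ((n + 1).factorial * (2 * b * Γ) ^ n) := by
    intro k l p q
    refine (norm_iteratedFDeriv_mul_le (hsm k p) (hsm q l) x le_rfl).trans ?_
    have : ∀ m ∈ Finset.range (n + 1), (n.choose m : ℝ) *
        ‖iteratedFDeriv ℝ m (fun x => green (Q + entryPert i j (L x)) z k p) x‖ *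
        ‖iteratedFDeriv ℝ (n - m) (fun x => green (Q + entryPert i j (L x)) z q l) x‖ ≤
        Γ * Γ * (n.factorial * (2 * b * Γ) ^ n) := by
      intro m hm
      have hmn : m ≤ n := Nat.lt_succ_iff.1 (Finset.mem_range.1 hm)
      have h2 : (n.choose m : ℝ) * m.factorial * (n - m).factorial = n.factorial := by
        exact_mod_cast Nat.choose_mul_factorial_mul_factorial hmn
      calc _ ≤ (n.choose m : ℝ) * (Γ * (m.factorial * (2 * b * Γ) ^ m)) *
            (Γ * ((n - m).factorial * (2 * b * Γ) ^ (n - m))) := by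
            gcongr
            · exact ih m (by omega) k p
            · exact ih (n - m) (by omega) q l
        _ = Γ * Γ * ((n.choose m * m.factorial * (n - m).factorial) *
            ((2 * b * Γ) ^ m * (2 * b * Γ) ^ (n - m))) := by ring
        _ = _ := by rw [h2, ← pow_add, Nat.add_sub_cancel' hmn]
    refine (Finset.sum_le_sum this).trans ?_
    rw [Finset.sum_const, Finset.card_range, nsmul_eq_mul, Nat.factorial_succ]
    push_cast
    exact le_of_eq (by ring)
  have hconj : ‖(Complex.conjCLE : ℂ →L[ℝ] ℂ).comp L‖ ≤ b :=
    ContinuousLinearMap.opNorm_le_bound _ hb0 fun y => by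
      simpa using L.le_of_opNorm_le hL y
  have hs1 : ContDiff ℝ n fun x => (green (Q + entryPert i j (L x)) z k i *
      green (Q + entryPert i j (L x)) z j l) • L := ((hsm _ _).mul (hsm _ _)).smul contDiff_const
  have hs2 : ContDiff ℝ n fun x => (green (Q + entryPert i j (L x)) z k j *
      green (Q + entryPert i j (L x)) z i l) • ((Complex.conjCLE : ℂ →L[ℝ] ℂ).comp L) :=
    ((hsm _ _).mul (hsm _ _)).smul contDiff_const
  rw [← norm_iteratedFDeriv_fderiv, e, iteratedFDeriv_neg_apply, norm_neg]
  rw [fun_iteratedFDeriv_add_apply hs1.contDiffAt hs2.contDiffAt]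
  refine (norm_add_le _ _).trans ?_
  have h1 := norm_iteratedFDeriv_smul_const_le ((hsm k i).mul (hsm j l)) L x
  have h2 := norm_iteratedFDeriv_smul_const_le ((hsm k j).mul (hsm i l))
    ((Complex.conjCLE : ℂ →L[ℝ] ℂ).comp L) x
  have h3 := hmul k l i j
  have h4 := hmul k l j i
  calc _ ≤ b * (Γ * Γ * ((n + 1).factorial * (2 * b * Γ) ^ n)) +
        b * (Γ * Γ * ((n + 1).factorial * (2 * b * Γ) ^ n)) := by
        refine add_le_add (h1.trans ?_) (h2.trans ?_) <;> gcongr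
    _ = _ := by rw [pow_succ]; ring

/-- Derivative bounds for the entries of a product of `k + 1` resolvents. -/
lemma norm_iteratedFDeriv_prod_green_apply_le (hQ : Q.IsHermitian) (hL : ‖L‖ ≤ b) {x : ℂ} :
    ∀ (k : ℕ) (z : Fin (k + 1) → ℂ), (∀ a, (z a).im ≠ 0) →
      (∀ a p q, ‖green (Q + entryPert i j (L x)) (z a) p q‖ ≤ Γ) → ∀ p q : Fin N,
      (∀ r : WithTop ℕ∞, ContDiff ℝ r fun x =>
        (List.ofFn fun a => green (Q + entryPert i j (L x)) (z a)).prod p q) ∧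
      ∀ n : ℕ, ‖iteratedFDeriv ℝ n (fun x =>
        (List.ofFn fun a => green (Q + entryPert i j (L x)) (z a)).prod p q) x‖ ≤
        (N : ℝ) ^ k * Γ ^ (k + 1) * (n.factorial * ((k + 1 : ℕ) * (2 * b * Γ)) ^ n)
  | 0, z, hz, hΓ, p, q => by
      have e : (fun x => (List.ofFn fun a => green (Q + entryPert i j (L x)) (z a)).prod p q) =
          fun x => green (Q + entryPert i j (L x)) (z 0) p q := by
        funext y; simp
      rw [e]
      refine ⟨fun r => contDiff_green_apply L hQ (hz 0) p q, fun n => ?_⟩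
      simpa using norm_iteratedFDeriv_green_apply_le hQ (hz 0) hL (hΓ 0) n p q
  | k + 1, z, hz, hΓ, p, q => by
      have hΓ0 : 0 ≤ Γ := (norm_nonneg _).trans (hΓ 0 p q)
      have hb0 : 0 ≤ b := (norm_nonneg _).trans hL
      have ih := norm_iteratedFDeriv_prod_green_apply_le hQ hL (x := x) k (fun a => z a.succ)
        (fun a => hz _) (fun a => hΓ _)
      have e : (fun x => (List.ofFn fun a => green (Q + entryPert i j (L x)) (z a)).prod p q) =
          fun x => ∑ m, green (Q + entryPert i j (L x)) (z 0) p m *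
            (List.ofFn fun a : Fin (k + 1) =>
              green (Q + entryPert i j (L x)) (z a.succ)).prod m q := by
        funext y; rw [List.ofFn_succ, List.prod_cons, Matrix.mul_apply]
      rw [e]
      have hG : ∀ m, ∀ r : WithTop ℕ∞, ContDiff ℝ r
          fun x => green (Q + entryPert i j (L x)) (z 0) p m :=
        fun m r => contDiff_green_apply L hQ (hz 0) p m
      refine ⟨fun r => ContDiff.sum fun m _ => (hG m r).mul ((ih m q).1 r), fun n => ?_⟩
      rw [iteratedFDeriv_fun_sum_apply fun m _ => ((hG m n).mul ((ih m q).1 n)).contDiffAt]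
      refine (norm_sum_le _ _).trans ?_
      have : ∀ m ∈ Finset.univ, ‖iteratedFDeriv ℝ n (fun x =>
          green (Q + entryPert i j (L x)) (z 0) p m * (List.ofFn fun a : Fin (k + 1) =>
              green (Q + entryPert i j (L x)) (z a.succ)).prod m q) x‖ ≤
          Γ * ((N : ℝ) ^ k * Γ ^ (k + 1)) *
            (n.factorial * (2 * b * Γ + (k + 1 : ℕ) * (2 * b * Γ)) ^ n) := fun m _ =>
        norm_iteratedFDeriv_mul_le_factorial (hG m n) ((ih m q).1 n) le_rfl (by positivity)
          (by positivity) (by positivity) (by positivity)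
          (fun s _ => norm_iteratedFDeriv_green_apply_le hQ (hz 0) hL (hΓ 0) s p m)
          (fun s _ => (ih m q).2 s)
      refine (Finset.sum_le_sum this).trans (le_of_eq ?_)
      rw [Finset.sum_const, Finset.card_univ, Fintype.card_fin, nsmul_eq_mul]
      push_cast
      ring

/-- The functions `N ^ (-k) Tr (G(z_1) ⋯ G(z_k))` of one matrix entry have derivatives of order
`n` bounded by `Γ ^ k * n ! * (2 k b Γ) ^ n`: the number of terms in the trace cancels against the
normalization. -/
lemma norm_iteratedFDeriv_trace_prod_green_le (hQ : Q.IsHermitian) (hL : ‖L‖ ≤ b) {x : ℂ}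
    {k : ℕ} (hk : 0 < k) (z : Fin k → ℂ) (hz : ∀ a, (z a).im ≠ 0)
    (hΓ : ∀ a p q, ‖green (Q + entryPert i j (L x)) (z a) p q‖ ≤ Γ) :
    (∀ r : WithTop ℕ∞, ContDiff ℝ r fun x => ((N : ℂ) ^ k)⁻¹ *
      (List.ofFn fun a => green (Q + entryPert i j (L x)) (z a)).prod.trace) ∧
    ∀ n : ℕ, ‖iteratedFDeriv ℝ n (fun x => ((N : ℂ) ^ k)⁻¹ *
      (List.ofFn fun a => green (Q + entryPert i j (L x)) (z a)).prod.trace) x‖ ≤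
        Γ ^ k * (n.factorial * (k * (2 * b * Γ)) ^ n) := by
  obtain ⟨k, rfl⟩ : ∃ k', k = k' + 1 := ⟨k - 1, by omega⟩
  have hN : (N : ℝ) ≠ 0 := by
    have := i.pos
    exact_mod_cast this.ne'
  have h := norm_iteratedFDeriv_prod_green_apply_le hQ hL (x := x) k z hz hΓ
  have hsum : ∀ r : WithTop ℕ∞, ContDiff ℝ r fun x =>
      (List.ofFn fun a => green (Q + entryPert i j (L x)) (z a)).prod.trace :=
    fun r => ContDiff.sum fun p _ => (h p p).1 r
  refine ⟨fun r => contDiff_const.mul (hsum r), fun n => ?_⟩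
  have e : ‖iteratedFDeriv ℝ n (fun x => ((N : ℂ) ^ (k + 1))⁻¹ *
      (List.ofFn fun a => green (Q + entryPert i j (L x)) (z a)).prod.trace) x‖ ≤
      ((N : ℝ) ^ (k + 1))⁻¹ * ‖iteratedFDeriv ℝ n (fun x =>
      (List.ofFn fun a => green (Q + entryPert i j (L x)) (z a)).prod.trace) x‖ := by
    have := norm_iteratedFDeriv_smul_const_le (hsum n) (((N : ℂ) ^ (k + 1))⁻¹) x
    simpa [mul_comm] using this
  refine e.trans ?_
  have h2 : ‖iteratedFDeriv ℝ n (fun x =>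
      (List.ofFn fun a => green (Q + entryPert i j (L x)) (z a)).prod.trace) x‖ ≤
      N * ((N : ℝ) ^ k * Γ ^ (k + 1) * (n.factorial * ((k + 1 : ℕ) * (2 * b * Γ)) ^ n)) := by
    simp only [Matrix.trace, Matrix.diag]
    rw [iteratedFDeriv_fun_sum_apply fun p _ => ((h p p).1 n).contDiffAt]
    refine (norm_sum_le _ _).trans ((Finset.sum_le_sum fun p _ => (h p p).2 n).trans ?_)
    rw [Finset.sum_const, Finset.card_univ, Fintype.card_fin, nsmul_eq_mul]
  calc _ ≤ ((N : ℝ) ^ (k + 1))⁻¹ *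
        (N * ((N : ℝ) ^ k * Γ ^ (k + 1) * (n.factorial * ((k + 1 : ℕ) * (2 * b * Γ)) ^ n))) := by
        gcongr
    _ = _ := by field_simp; ring

/-- The partial derivatives in the coordinate directions control the norm of the multilinear
map. -/
lemma norm_le_of_coordDir {n a : ℕ} {B : ℝ} (hB : 0 ≤ B)
    (M : ContinuousMultilinearMap ℝ (fun _ : Fin a => Fin n → ℂ) ℂ)
    (h : ∀ d : Fin a → Fin n × Bool, ‖M fun l => coordDir (d l)‖ ≤ B) :
    ‖M‖ ≤ (2 * n) ^ a * B := by
  refine ContinuousMultilinearMap.opNorm_le_bound (by positivity) fun v => ?_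
  have hv : v = fun l => ∑ d : Fin n × Bool,
      (if d.2 then (v l d.1).im else (v l d.1).re) • coordDir d := by
    funext l
    rw [Fintype.sum_prod_type]
    funext m
    simp only [Fintype.sum_bool, Finset.sum_apply, Pi.add_apply, Pi.smul_apply, coordDir]
    rw [Finset.sum_eq_single_of_mem m (Finset.mem_univ _)]
    · apply Complex.ext <;> simp
    · intro m' _ hm
      simp [Pi.single_eq_of_ne' hm]
  conv_lhs => rw [hv]
  rw [M.map_sum]
  refine (norm_sum_le _ _).trans ?_
  have : ∀ r ∈ (Finset.univ : Finset (Fin a → Fin n × Bool)), ‖M fun l =>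
      (if (r l).2 then (v l (r l).1).im else (v l (r l).1).re) • coordDir (r l)‖ ≤
      B * ∏ l, ‖v l‖ := by
    intro r _
    rw [M.map_smul_univ, norm_smul, mul_comm, norm_prod]
    gcongr with l
    · exact h r
    · have h1 : ‖v l (r l).1‖ ≤ ‖v l‖ := norm_le_pi_norm _ _
      split_ifs
      · exact (Complex.abs_im_le_norm _).trans h1
      · exact (Complex.abs_re_le_norm _).trans h1
  refine (Finset.sum_le_sum this).trans (le_of_eq ?_)
  rw [Finset.sum_const, Finset.card_univ, nsmul_eq_mul]
  simp
  ring

variable {n K : ℕ} {k : Fin n → ℕ} {z : (m : Fin n) → Fin (k m) → ℂ} {F : (Fin n → ℂ) → ℂ}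

lemma norm_greenTraces_apply_le (hk : ∀ m, 0 < k m) (hz : ∀ m a, (z m a).im ≠ 0)
    (hQ : Q.IsHermitian) (i : Fin N)
    (hΓ : ∀ m a p q, ‖green Q (z m a) p q‖ ≤ Γ) (m : Fin n) :
    ‖greenTraces z Q m‖ ≤ Γ ^ k m := by
  have e : Q + entryPert i i ((0 : ℂ →L[ℝ] ℂ) 0) = Q := by simp [entryPert]
  have h := (norm_iteratedFDeriv_trace_prod_green_le (i := i) (j := i) (L := 0) (b := 0) (x := 0)
    hQ (by simp) (hk m) (z m) (hz m) (by rw [e]; exact hΓ m)).2 0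
  rw [norm_iteratedFDeriv_zero] at h
  rw [e] at h
  simpa [greenTraces] using h

lemma contDiff_greenTraces (L : ℂ →L[ℝ] ℂ) (hk : ∀ m, 0 < k m) (hz : ∀ m a, (z m a).im ≠ 0)
    (hQ : Q.IsHermitian) (r : WithTop ℕ∞) :
    ContDiff ℝ r fun x => greenTraces z (Q + entryPert i j (L x)) := by
  refine contDiff_pi.2 fun m => ?_
  let Γ := ∑ a, ∑ p, ∑ q, ‖green (Q + entryPert i j (L 0)) (z m a) p q‖
  refine (norm_iteratedFDeriv_trace_prod_green_le hQ le_rfl (x := 0) (Γ := Γ) (hk m) (z m) (hz m)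
    fun a p q => ?_).1 r
  calc _ ≤ ∑ q, ‖green (Q + entryPert i j (L 0)) (z m a) p q‖ :=
        Finset.single_le_sum (f := fun q => ‖green (Q + entryPert i j (L 0)) (z m a) p q‖)
          (fun _ _ => by positivity) (Finset.mem_univ q)
    _ ≤ ∑ p, ∑ q, ‖green (Q + entryPert i j (L 0)) (z m a) p q‖ :=
        Finset.single_le_sum (f := fun p => ∑ q, ‖green (Q + entryPert i j (L 0)) (z m a) p q‖)
          (fun _ _ => by positivity) (Finset.mem_univ p)
    _ ≤ _ := Finset.single_le_sum
          (f := fun a => ∑ p, ∑ q, ‖green (Q + entryPert i j (L 0)) (z m a) p q‖)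
          (fun _ _ => by positivity) (Finset.mem_univ a)

/-- Chain rule: bounds for the partial derivatives of `F` at one point and for the resolvent
entries bound the derivatives of the observable in one matrix entry, with a factor
`b * Γ ^ (K + 1)` per derivative. -/
theorem norm_iteratedFDeriv_comp_greenTraces_le (hk : ∀ m, 0 < k m) (hK : ∑ m, k m = K)
    (hz : ∀ m a, (z m a).im ≠ 0) (hF : ContDiff ℝ 5 F) (hQ : Q.IsHermitian) (hL : ‖L‖ ≤ b)
    (hΓ1 : 1 ≤ Γ) {x : ℂ} (hΓ : ∀ m a p q, ‖green (Q + entryPert i j (L x)) (z m a) p q‖ ≤ Γ)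
    {B : ℝ} (hB : PartialsBoundedAt F (greenTraces z (Q + entryPert i j (L x))) B) (hB0 : 0 ≤ B)
    {a : ℕ} (ha1 : 1 ≤ a) (ha : a ≤ 5) :
    ‖iteratedFDeriv ℝ a (fun x => F (greenTraces z (Q + entryPert i j (L x)))) x‖ ≤
      a.factorial * ((2 * K + 1) ^ 5 * B) * (240 * K * b * Γ ^ (K + 1)) ^ a := by
  have hb0 : 0 ≤ b := (norm_nonneg _).trans hL
  set T : ℂ → Fin n → ℂ := fun x => greenTraces z (Q + entryPert i j (L x)) with hT
  -- The general bound for compositions involves the size of the outer function itself, which is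
  -- not controlled; subtracting its value at the base point removes it.
  set F' : (Fin n → ℂ) → ℂ := fun y => F y - F (T x)
  have hkK : ∀ m, k m ≤ K := fun m => by
    rw [← hK]; exact Finset.single_le_sum (fun _ _ => Nat.zero_le _) (Finset.mem_univ m)
  have hnK : n ≤ K := by
    rw [← hK]
    calc n = ∑ _m : Fin n, 1 := by simp
      _ ≤ _ := Finset.sum_le_sum fun m _ => hk m
  have hF' : ContDiff ℝ 5 F' := hF.sub contDiff_const
  have e : ∀ s : ℕ, 1 ≤ s → ∀ {W : Type} [NormedAddCommGroup W] [NormedSpace ℝ W] (g : W → ℂ)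
      (y : W), ContDiff ℝ s g →
      iteratedFDeriv ℝ s (fun y => g y - F (T x)) y = iteratedFDeriv ℝ s g y := by
    intro s hs W _ _ g y hg
    have := iteratedFDeriv_sub_apply (x := y) hg.contDiffAt
      (contDiff_const (c := F (T x))).contDiffAt
    have e2 : (fun y => g y - F (T x)) = g - fun _ => F (T x) := rfl
    rw [e2, this, iteratedFDeriv_const_of_ne (by omega)]
    simp
  have hTs : ContDiff ℝ 5 T := contDiff_greenTraces L hk hz hQ 5
  have hcomp : ContDiff ℝ a fun x => F (T x) :=
    (hF.comp hTs).of_le (by exact_mod_cast ha)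
  rw [← e a ha1 (fun x => F (T x)) x hcomp]
  refine norm_iteratedFDeriv_comp_le (g := F') (f := T) hF' hTs (by exact_mod_cast ha) x ?_ ?_
  · intro s hs
    obtain rfl | hs1 := Nat.eq_zero_or_pos s
    · rw [norm_iteratedFDeriv_zero]
      simp only [F', sub_self, norm_zero]
      positivity
    · rw [e s hs1 F (T x) (hF.of_le (by exact_mod_cast hs.trans ha))]
      refine (norm_le_of_coordDir hB0 _ (hB s hs1 (hs.trans ha))).trans ?_
      gcongr
      calc (2 * (n : ℝ)) ^ s ≤ (2 * K + 1) ^ s := by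
            gcongr
            have : (n : ℝ) ≤ K := by exact_mod_cast hnK
            linarith
        _ ≤ (2 * K + 1) ^ 5 := pow_le_pow_right₀ (by linarith [(Nat.cast_nonneg K : (0:ℝ) ≤ K)])
            (hs.trans ha)
  · intro s hs1 hs
    have hpi : ∀ m, ‖iteratedFDeriv ℝ s (fun x => T x m) x‖ ≤ (240 * K * b * Γ ^ (K + 1)) ^ s := by
      intro m
      refine ((norm_iteratedFDeriv_trace_prod_green_le hQ hL (hk m) (z m) (hz m) (hΓ m)).2
        s).trans ?_
      have h1 : (s.factorial : ℝ) ≤ 120 := by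
        exact_mod_cast Nat.factorial_le (hs.trans ha)
      have h2 : (k m : ℝ) ≤ K := by exact_mod_cast hkK m
      -- as `s ≥ 1`, the prefactor `120 * Γ ^ K` may be raised to the power `s`
      have h3 : 1 ≤ 120 * Γ ^ K := by nlinarith [one_le_pow₀ (n := K) hΓ1]
      calc Γ ^ k m * (s.factorial * (k m * (2 * b * Γ)) ^ s)
          ≤ Γ ^ K * (120 * (K * (2 * b * Γ)) ^ s) := by
            gcongr
            · exact hkK m
        _ = (120 * Γ ^ K) ^ 1 * (K * (2 * b * Γ)) ^ s := by ring
        _ ≤ (120 * Γ ^ K) ^ s * (K * (2 * b * Γ)) ^ s := by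
            gcongr
        _ = _ := by rw [← mul_pow]; congr 1; ring
    refine ContinuousMultilinearMap.opNorm_le_bound (by positivity) fun v => ?_
    refine (pi_norm_le_iff_of_nonneg (by positivity)).2 fun m => ?_
    have h1 := (ContinuousLinearMap.proj (R := ℝ) (φ := fun _ : Fin n => ℂ)
      m).iteratedFDeriv_comp_left (x := x) (i := s)
      (hTs.contDiffAt.of_le (show (s : WithTop ℕ∞) ≤ 5 by exact_mod_cast hs.trans ha)) le_rfl
    have h2 : iteratedFDeriv ℝ s T x v m = iteratedFDeriv ℝ s (fun x => T x m) x v := by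
      exact (congrFun (congrArg DFunLike.coe h1) v).symm
    rw [h2]
    exact ContinuousMultilinearMap.le_of_opNorm_le (hpi m) v

end Bounds

/-! ### Fifth order Taylor expansion and matching of moments -/

section Taylor

lemma iteratedDeriv_comp_smul_right {f : ℂ → ℂ} {n : ℕ} (hf : ContDiff ℝ n f) (x : ℂ) (t : ℝ) :
    iteratedDeriv n (fun t : ℝ => f (t • x)) t = iteratedFDeriv ℝ n f (t • x) fun _ => x := by
  have h := (ContinuousLinearMap.toSpanSingleton ℝ x).iteratedFDeriv_comp_right hf t le_rfl
  rw [iteratedDeriv_eq_iteratedFDeriv]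
  have e : (fun t : ℝ => f (t • x)) = f ∘ (ContinuousLinearMap.toSpanSingleton ℝ x) := by
    funext t; simp
  rw [e, h]
  simp

/-- Taylor's theorem along the segment from `0` to `x`. -/
lemma norm_sub_taylor_le {f : ℂ → ℂ} (hf : ContDiff ℝ 5 f) {x : ℂ} {B : ℝ}
    (hB : ∀ t ∈ Set.Icc (0 : ℝ) 1, ‖iteratedFDeriv ℝ 5 f (t • x)‖ ≤ B) :
    ‖f x - ∑ a ∈ Finset.range 5, ((a.factorial : ℝ)⁻¹) • iteratedFDeriv ℝ a f 0 fun _ => x‖ ≤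
      B * ‖x‖ ^ 5 := by
  set g : ℝ → ℂ := fun t => f (t • x) with hg
  have hgs : ContDiff ℝ 5 g := hf.comp (contDiff_id.smul contDiff_const)
  have hB0 : 0 ≤ B := (norm_nonneg _).trans (hB 0 (by simp))
  have hd : ∀ a : ℕ, a ≤ 5 → ∀ t ∈ Set.Icc (0 : ℝ) 1, iteratedDerivWithin a g (Set.Icc 0 1) t =
      iteratedFDeriv ℝ a f (t • x) fun _ => x := by
    intro a ha t ht
    rw [iteratedDerivWithin_eq_iteratedDeriv (uniqueDiffOn_Icc zero_lt_one)
      ((hgs.of_le (by exact_mod_cast ha)).contDiffAt) ht]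
    exact iteratedDeriv_comp_smul_right (hf.of_le (by exact_mod_cast ha)) x t
  have h := taylor_mean_remainder_bound (f := g) (a := 0) (b := 1) (x := 1) (n := 4)
    (C := B * ‖x‖ ^ 5) zero_le_one (by exact_mod_cast hgs.contDiffOn) (by simp) (by
      intro t ht
      rw [hd 5 le_rfl t ht]
      have := (iteratedFDeriv ℝ 5 f (t • x)).le_of_opNorm_le (hB t ht) (fun _ => x)
      simpa using this)
  rw [taylor_within_apply] at h
  have e : ∑ k ∈ Finset.range (4 + 1), ((k.factorial : ℝ)⁻¹ * (1 - 0) ^ k) •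
      iteratedDerivWithin k g (Set.Icc 0 1) 0 =
      ∑ a ∈ Finset.range 5, ((a.factorial : ℝ)⁻¹) • iteratedFDeriv ℝ a f 0 fun _ => x := by
    refine Finset.sum_congr rfl fun a ha => ?_
    rw [hd a (by have := Finset.mem_range.1 ha; omega) 0 (by simp)]
    simp
  rw [e] at h
  have h1 : g 1 = f x := by simp [hg]
  rw [h1] at h
  refine h.trans ?_
  have hp : 0 ≤ B * ‖x‖ ^ 5 := by positivity
  rw [sub_zero, one_pow, mul_one]
  exact div_le_self hp (by exact_mod_cast Nat.one_le_iff_ne_zero.2 (Nat.factorial_ne_zero 4))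

/-- The factors `x` and `conj x`. -/
noncomputable def conjIf (c : Bool) (x : ℂ) : ℂ := if c then starRingEnd ℂ x else x

lemma prod_conjIf {a : ℕ} (u : Fin a → Bool) : ∃ s ≤ a, ∀ x : ℂ,
    ∏ l, conjIf (u l) x = (starRingEnd ℂ x) ^ s * x ^ (a - s) := by
  refine ⟨(Finset.univ.filter fun l => u l = true).card, ?_, fun x => ?_⟩
  · simpa using Finset.card_filter_le (Finset.univ : Finset (Fin a)) fun l => u l = true
  · have h := Finset.card_filter_add_card_filter_not (s := (Finset.univ : Finset (Fin a)))
      (fun l => u l = true)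
    simp only [conjIf]
    rw [Finset.prod_ite, Finset.prod_const, Finset.prod_const]
    congr 2
    simp only [Finset.card_univ, Fintype.card_fin] at h
    omega

/-- The coefficients that express real and imaginary part through `x` and `conj x`. -/
noncomputable def reImCoeff (r c : Bool) : ℂ :=
  if r then (if c then Complex.I / 2 else -Complex.I / 2) else 1 / 2

lemma norm_reImCoeff (r c : Bool) : ‖reImCoeff r c‖ = 1 / 2 := by
  cases r <;> cases c <;> simp [reImCoeff]

lemma reIm_eq_sum (r : Bool) (x : ℂ) :
    (((if r then x.im else x.re) : ℝ) : ℂ) = ∑ c, reImCoeff r c * conjIf c x := by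
  cases r <;> apply Complex.ext <;> simp [reImCoeff, conjIf] <;> ring

/-- A real-multilinear form on the diagonal of `ℂ` is a polynomial in `x` and `conj x`. -/
lemma multilinear_apply_diag {a : ℕ}
    (M : ContinuousMultilinearMap ℝ (fun _ : Fin a => ℂ) ℂ) (x : ℂ) :
    M (fun _ => x) = ∑ r : Fin a → Bool, ∑ u : Fin a → Bool,
      ((∏ l, reImCoeff (r l) (u l)) * M fun l => if r l then Complex.I else 1) *
        ∏ l, conjIf (u l) x := by
  have hx : (fun _ : Fin a => x) = fun _ => ∑ r : Bool,
      (if r then x.im else x.re) • (if r then Complex.I else 1 : ℂ) := by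
    funext _
    apply Complex.ext <;> simp
  conv_lhs => rw [hx]
  rw [M.map_sum]
  refine Finset.sum_congr rfl fun r _ => ?_
  rw [M.map_smul_univ, Complex.real_smul, Complex.ofReal_prod]
  simp_rw [reIm_eq_sum]
  rw [Finset.prod_univ_sum, Finset.sum_mul, Fintype.piFinset_univ]
  refine Finset.sum_congr rfl fun u _ => ?_
  rw [Finset.prod_mul_distrib]; ring

variable {ρ ρ' : Measure ℂ}

lemma integrable_prod_conjIf {a : ℕ} (hρ : Integrable (fun x : ℂ => ‖x‖ ^ a) ρ)
    (u : Fin a → Bool) : Integrable (fun x => ∏ l, conjIf (u l) x) ρ := by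
  obtain ⟨s, hs, h⟩ := prod_conjIf u
  simp_rw [h]
  refine hρ.mono' (by
    have : Continuous fun x : ℂ => (starRingEnd ℂ x) ^ s * x ^ (a - s) := by
      have := Complex.continuous_conj
      fun_prop
    exact this.aestronglyMeasurable) (Filter.Eventually.of_forall fun x => ?_)
  rw [norm_mul, norm_pow, norm_pow, RCLike.norm_conj, ← pow_add, Nat.add_sub_cancel' hs]

lemma integrable_multilinear_diag {a : ℕ} (hρ : Integrable (fun x : ℂ => ‖x‖ ^ a) ρ)
    (M : ContinuousMultilinearMap ℝ (fun _ : Fin a => ℂ) ℂ) :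
    Integrable (fun x => M fun _ => x) ρ := by
  simp_rw [multilinear_apply_diag M]
  exact integrable_finsetSum _ fun r _ => integrable_finsetSum _ fun u _ =>
    (integrable_prod_conjIf hρ u).const_mul _

/-- Expectations of a multilinear form of degree `a` differ by at most the largest difference of
the mixed moments of order `a`, up to a constant. -/
lemma norm_integral_multilinear_sub_le {a : ℕ} (hρ : Integrable (fun x : ℂ => ‖x‖ ^ a) ρ)
    (hρ' : Integrable (fun x : ℂ => ‖x‖ ^ a) ρ')
    (M : ContinuousMultilinearMap ℝ (fun _ : Fin a => ℂ) ℂ) {m : ℝ}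
    (hm : ∀ s ≤ a, ‖(∫ x, (starRingEnd ℂ x) ^ s * x ^ (a - s) ∂ρ) -
      ∫ x, (starRingEnd ℂ x) ^ s * x ^ (a - s) ∂ρ'‖ ≤ m) :
    ‖(∫ x, M (fun _ => x) ∂ρ) - ∫ x, M (fun _ => x) ∂ρ'‖ ≤ 2 ^ a * (‖M‖ * m) := by
  have hm0 : 0 ≤ m := (norm_nonneg _).trans (hm 0 (Nat.zero_le _))
  have e : ∀ (σ : Measure ℂ), Integrable (fun x : ℂ => ‖x‖ ^ a) σ →
      ∫ x, M (fun _ => x) ∂σ = ∑ r : Fin a → Bool, ∑ u : Fin a → Bool,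
      ((∏ l, reImCoeff (r l) (u l)) * M fun l => if r l then Complex.I else 1) *
        ∫ x, ∏ l, conjIf (u l) x ∂σ := by
    intro σ hσ
    simp_rw [multilinear_apply_diag M]
    rw [integral_finsetSum _ fun r _ => integrable_finsetSum _ fun u _ =>
      (integrable_prod_conjIf hσ u).const_mul _]
    refine Finset.sum_congr rfl fun r _ => ?_
    rw [integral_finsetSum _ fun u _ => (integrable_prod_conjIf hσ u).const_mul _]
    refine Finset.sum_congr rfl fun u _ => ?_
    rw [integral_const_mul]
  rw [e ρ hρ, e ρ' hρ', ← Finset.sum_sub_distrib]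
  simp_rw [← Finset.sum_sub_distrib, ← mul_sub]
  have hterm : ∀ r u : Fin a → Bool, ‖((∏ l, reImCoeff (r l) (u l)) *
      M fun l => if r l then Complex.I else 1) *
        ((∫ x, ∏ l, conjIf (u l) x ∂ρ) - ∫ x, ∏ l, conjIf (u l) x ∂ρ')‖ ≤
      (1 / 2) ^ a * (‖M‖ * m) := by
    intro r u
    obtain ⟨s, hs, h⟩ := prod_conjIf u
    simp_rw [h]
    rw [norm_mul, norm_mul, norm_prod, mul_assoc]
    simp_rw [norm_reImCoeff]
    rw [Finset.prod_const, Finset.card_univ, Fintype.card_fin]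
    gcongr
    · have := M.le_opNorm fun l => if r l then Complex.I else 1
      refine this.trans (le_of_eq ?_)
      have h1 : ∀ l, ‖(if r l then Complex.I else 1 : ℂ)‖ = 1 := fun l => by split_ifs <;> simp
      simp_rw [h1]
      simp
    · exact hm s hs
  refine (norm_sum_le_of_le _ fun r _ => norm_sum_le_of_le _ fun u _ => hterm r u).trans
    (le_of_eq ?_)
  simp only [Finset.sum_const, Finset.card_univ, Fintype.card_pi, Fintype.card_bool,
    Finset.prod_const, Fintype.card_fin, nsmul_eq_mul]
  push_cast
  have : (2 : ℝ) ^ a * (1 / 2) ^ a = 1 := by rw [← mul_pow]; norm_num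
  linear_combination (2 ^ a * (‖M‖ * m)) * this

/-- Replacement of one random variable: if the moments up to order three agree and those of order
four differ by at most `m`, then the expectations of a `C ^ 5` function differ by the fourth order
term and the fifth order remainder. The remainder is estimated by `D₅` for arguments up to `R`,
and with the help of a high moment by the larger constant `D₅'` beyond. -/
lemma norm_integral_sub_integral_le [IsProbabilityMeasure ρ] [IsProbabilityMeasure ρ']
    {f : ℂ → ℂ} (hf : ContDiff ℝ 5 f) {D₄ D₅ D₅' R A m : ℝ} (r : ℕ)
    (hR : 0 < R) (h4 : ‖iteratedFDeriv ℝ 4 f 0‖ ≤ D₄)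
    (h5 : ∀ x, ‖x‖ ≤ R → ‖iteratedFDeriv ℝ 5 f x‖ ≤ D₅)
    (h5' : ∀ x, ‖iteratedFDeriv ℝ 5 f x‖ ≤ D₅')
    (hρ : ∀ q : ℕ, Integrable (fun x : ℂ => ‖x‖ ^ q) ρ)
    (hρ' : ∀ q : ℕ, Integrable (fun x : ℂ => ‖x‖ ^ q) ρ')
    (hA : ∫ x, ‖x‖ ^ (5 + r) ∂ρ ≤ A) (hA' : ∫ x, ‖x‖ ^ (5 + r) ∂ρ' ≤ A)
    (hm3 : ∀ s u : ℕ, s + u ≤ 3 → ∫ x, (starRingEnd ℂ x) ^ s * x ^ u ∂ρ =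
      ∫ x, (starRingEnd ℂ x) ^ s * x ^ u ∂ρ')
    (hm4 : ∀ s ≤ 4, ‖(∫ x, (starRingEnd ℂ x) ^ s * x ^ (4 - s) ∂ρ) -
      ∫ x, (starRingEnd ℂ x) ^ s * x ^ (4 - s) ∂ρ'‖ ≤ m)
    (hfρ : Integrable f ρ) (hfρ' : Integrable f ρ') :
    ‖(∫ x, f x ∂ρ) - ∫ x, f x ∂ρ'‖ ≤ D₄ * m + 2 * (D₅ * R ^ 5 + D₅' * A / R ^ r) := by
  have hm0 : 0 ≤ m := (norm_nonneg _).trans (hm4 0 (Nat.zero_le _))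
  have hD5 : 0 ≤ D₅ := (norm_nonneg _).trans (h5 0 (by simpa using hR.le))
  have hD5' : 0 ≤ D₅' := (norm_nonneg _).trans (h5' 0)
  set P : ℂ → ℂ := fun x =>
    ∑ a ∈ Finset.range 5, ((a.factorial : ℝ)⁻¹) • iteratedFDeriv ℝ a f 0 fun _ => x with hP
  have hrem : ∀ x, ‖f x - P x‖ ≤ D₅ * R ^ 5 + D₅' / R ^ r * ‖x‖ ^ (5 + r) := by
    intro x
    rcases le_or_gt ‖x‖ R with hx | hx
    · have h := norm_sub_taylor_le hf (x := x) (B := D₅) fun t ht => h5 _ (by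
        rw [norm_smul, Real.norm_of_nonneg ht.1]
        nlinarith [norm_nonneg x, ht.2])
      have h2 : D₅ * ‖x‖ ^ 5 ≤ D₅ * R ^ 5 := by gcongr
      have h3 : 0 ≤ D₅' / R ^ r * ‖x‖ ^ (5 + r) := by positivity
      linarith
    · have h := norm_sub_taylor_le hf (x := x) (B := D₅') fun t _ => h5' _
      have h3 : 0 ≤ D₅ * R ^ 5 := by positivity
      have h2 : D₅' * ‖x‖ ^ 5 ≤ D₅' / R ^ r * ‖x‖ ^ (5 + r) := by
        rw [pow_add, div_mul_eq_mul_div, le_div_iff₀ (by positivity)]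
        have : R ^ r ≤ ‖x‖ ^ r := by gcongr
        calc _ ≤ D₅' * ‖x‖ ^ 5 * ‖x‖ ^ r := by gcongr
          _ = _ := by ring
      linarith
  have hterm : ∀ (σ : Measure ℂ), (∀ q : ℕ, Integrable (fun x : ℂ => ‖x‖ ^ q) σ) → ∀ a : ℕ,
      Integrable (fun x => ((a.factorial : ℝ)⁻¹) • iteratedFDeriv ℝ a f 0 fun _ => x) σ :=
    fun σ hσ a => (integrable_multilinear_diag (hσ a) (iteratedFDeriv ℝ a f 0)).smul
      ((a.factorial : ℝ)⁻¹)
  have hPint : ∀ (σ : Measure ℂ), (∀ q : ℕ, Integrable (fun x : ℂ => ‖x‖ ^ q) σ) →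
      Integrable P σ := fun σ hσ => integrable_finsetSum _ fun a _ => hterm σ hσ a
  have hint : ∀ (σ : Measure ℂ), (∀ q : ℕ, Integrable (fun x : ℂ => ‖x‖ ^ q) σ) →
      IsProbabilityMeasure σ → Integrable f σ → ∫ x, ‖x‖ ^ (5 + r) ∂σ ≤ A →
      ‖(∫ x, f x ∂σ) - ∫ x, P x ∂σ‖ ≤ D₅ * R ^ 5 + D₅' * A / R ^ r := by
    intro σ hσ hσp hfσ hσA
    rw [← integral_sub hfσ (hPint σ hσ)]
    refine (norm_integral_le_of_norm_le ((integrable_const _).add ((hσ (5 + r)).const_mul _))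
      (Filter.Eventually.of_forall hrem)).trans ?_
    rw [integral_add' (integrable_const _) ((hσ (5 + r)).const_mul _), integral_const,
      probReal_univ, one_smul, integral_const_mul]
    have : D₅' / R ^ r * ∫ x, ‖x‖ ^ (5 + r) ∂σ ≤ D₅' / R ^ r * A := by gcongr
    calc _ ≤ D₅ * R ^ 5 + D₅' / R ^ r * A := by linarith
      _ = _ := by ring
  have hPeq : ∀ (σ : Measure ℂ), (∀ q : ℕ, Integrable (fun x : ℂ => ‖x‖ ^ q) σ) →
      ∫ x, P x ∂σ = ∑ a ∈ Finset.range 5, ((a.factorial : ℝ)⁻¹) •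
        ∫ x, iteratedFDeriv ℝ a f 0 (fun _ => x) ∂σ := fun σ hσ => by
    rw [hP, integral_finsetSum _ fun a _ => hterm σ hσ a]
    exact Finset.sum_congr rfl fun a _ => integral_smul _ _
  have hlow : ∀ a ≤ 3, ∫ x, iteratedFDeriv ℝ a f 0 (fun _ => x) ∂ρ =
      ∫ x, iteratedFDeriv ℝ a f 0 (fun _ => x) ∂ρ' := by
    intro a ha
    have h := norm_integral_multilinear_sub_le (hρ a) (hρ' a) (iteratedFDeriv ℝ a f 0) (m := 0)
      fun s hs => by rw [hm3 s (a - s) (by omega), sub_self, norm_zero]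
    rw [mul_zero, mul_zero] at h
    exact sub_eq_zero.1 (norm_le_zero_iff.1 h)
  have hPdiff : ‖(∫ x, P x ∂ρ) - ∫ x, P x ∂ρ'‖ ≤ D₄ * m := by
    have hsum : ∑ a ∈ Finset.range 4, ((a.factorial : ℝ)⁻¹) •
        ∫ x, iteratedFDeriv ℝ a f 0 (fun _ => x) ∂ρ = ∑ a ∈ Finset.range 4,
        ((a.factorial : ℝ)⁻¹) • ∫ x, iteratedFDeriv ℝ a f 0 (fun _ => x) ∂ρ' :=
      Finset.sum_congr rfl fun a ha => by
        rw [hlow a (by have := Finset.mem_range.1 ha; omega)]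
    rw [hPeq ρ hρ, hPeq ρ' hρ', Finset.sum_range_succ _ 4, Finset.sum_range_succ _ 4, hsum,
      add_sub_add_left_eq_sub, ← smul_sub, norm_smul]
    have h := norm_integral_multilinear_sub_le (hρ 4) (hρ' 4) (iteratedFDeriv ℝ 4 f 0) hm4
    have h' : ‖iteratedFDeriv ℝ 4 f 0‖ * m ≤ D₄ * m := by gcongr
    have h'' : 0 ≤ ‖iteratedFDeriv ℝ 4 f 0‖ * m := by positivity
    have hfac : ‖((Nat.factorial 4 : ℝ)⁻¹)‖ = 1 / 24 := by norm_num [Nat.factorial]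
    rw [hfac]
    nlinarith
  have h1 := hint ρ hρ inferInstance hfρ hA
  have h2 := hint ρ' hρ' inferInstance hfρ' hA'
  have e : (∫ x, f x ∂ρ) - ∫ x, f x ∂ρ' = ((∫ x, f x ∂ρ) - ∫ x, P x ∂ρ) +
      ((∫ x, P x ∂ρ) - ∫ x, P x ∂ρ') - ((∫ x, f x ∂ρ') - ∫ x, P x ∂ρ') := by ring
  rw [e]
  refine (norm_sub_le _ _).trans ?_
  have h3 := norm_add_le ((∫ x, f x ∂ρ) - ∫ x, P x ∂ρ) ((∫ x, P x ∂ρ) - ∫ x, P x ∂ρ')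
  linarith

end Taylor

/-! ### Moments of subexponential random variables -/

section Moments

lemma summable_pow_mul_exp_neg_rpow {ϑ : ℝ} (hϑ : 0 < ϑ) (q : ℕ) :
    Summable fun j : ℕ => ((j : ℝ) + 1) ^ q * Real.exp (-(j : ℝ) ^ ϑ) := by
  obtain ⟨k, hk⟩ := exists_nat_ge ((q + 2) / ϑ)
  have hk' : (q : ℝ) + 2 ≤ ϑ * k := by rwa [div_le_iff₀' hϑ] at hk
  refine Summable.of_norm_bounded_eventually_nat (g := fun j : ℕ =>
    (2 ^ q * k.factorial : ℝ) * ((j : ℝ) ^ 2)⁻¹)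
    ((Real.summable_nat_pow_inv.2 one_lt_two).mul_left _) ?_
  filter_upwards [Filter.eventually_ge_atTop 1] with j hj
  have hj1 : (1 : ℝ) ≤ j := by exact_mod_cast hj
  have hj0 : (0 : ℝ) < j := by linarith
  rw [Real.norm_of_nonneg (by positivity)]
  have h1 : ((j : ℝ) + 1) ^ q ≤ 2 ^ q * (j : ℝ) ^ q := by
    rw [← mul_pow]; gcongr; linarith
  have h2 : (j : ℝ) ^ (q + 2) ≤ k.factorial * Real.exp ((j : ℝ) ^ ϑ) := by
    have h := Real.pow_div_factorial_le_exp ((j : ℝ) ^ ϑ) (by positivity) k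
    rw [div_le_iff₀ (by positivity)] at h
    refine le_trans ?_ (h.trans_eq (mul_comm _ _))
    rw [← Real.rpow_natCast, ← Real.rpow_natCast, ← Real.rpow_mul hj0.le]
    exact Real.rpow_le_rpow_of_exponent_le hj1 (by push_cast; exact hk')
  calc ((j : ℝ) + 1) ^ q * Real.exp (-(j : ℝ) ^ ϑ)
      ≤ 2 ^ q * (j : ℝ) ^ q * Real.exp (-(j : ℝ) ^ ϑ) := by gcongr
    _ = 2 ^ q * ((j : ℝ) ^ 2)⁻¹ * ((j : ℝ) ^ (q + 2) * Real.exp (-(j : ℝ) ^ ϑ)) := by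
        rw [pow_add]; field_simp
    _ ≤ 2 ^ q * ((j : ℝ) ^ 2)⁻¹ * (k.factorial * Real.exp ((j : ℝ) ^ ϑ) *
          Real.exp (-(j : ℝ) ^ ϑ)) := by gcongr
    _ = _ := by
        rw [mul_assoc (k.factorial : ℝ), ← Real.exp_add, add_neg_cancel, Real.exp_zero]; ring

universe u

/-- All moments are finite, with bounds that depend only on the constants of the decay. -/
lemma exists_moment_bound (C : ℝ) {ϑ : ℝ} (hC : 0 < C) (hϑ : 0 < ϑ) (q : ℕ) :
    ∃ A : ℝ, ∀ (Ω : Type u) [MeasurableSpace Ω] (μ : Measure Ω) [IsProbabilityMeasure μ]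
      (X : Ω → ℂ), Measurable X →
      (∀ x : ℝ, 0 < x → μ.real {ω | x ≤ ‖X ω‖} ≤ C * Real.exp (-x ^ ϑ)) →
      Integrable (fun ω => ‖X ω‖ ^ q) μ ∧ ∫ ω, ‖X ω‖ ^ q ∂μ ≤ A := by
  have hs := (summable_pow_mul_exp_neg_rpow hϑ q).mul_left (C + 1)
  refine ⟨∑' j : ℕ, (C + 1) * (((j : ℝ) + 1) ^ q * Real.exp (-(j : ℝ) ^ ϑ)),
    fun Ω _ μ _ X hX hdec => ?_⟩
  set S := ∑' j : ℕ, (C + 1) * (((j : ℝ) + 1) ^ q * Real.exp (-(j : ℝ) ^ ϑ)) with hS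
  have hlev : ∀ j : ℕ, μ {ω | (j : ℝ) ≤ ‖X ω‖} ≤
      ENNReal.ofReal ((C + 1) * Real.exp (-(j : ℝ) ^ ϑ)) := by
    intro j
    rcases Nat.eq_zero_or_pos j with rfl | hj
    · rw [Nat.cast_zero, Real.zero_rpow hϑ.ne', neg_zero, Real.exp_zero, mul_one]
      refine prob_le_one.trans ?_
      rw [← ENNReal.ofReal_one]
      exact ENNReal.ofReal_le_ofReal (by linarith)
    · rw [← ofReal_measureReal (measure_ne_top _ _)]
      refine ENNReal.ofReal_le_ofReal ((hdec j (by exact_mod_cast hj)).trans ?_)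
      gcongr
      linarith
  -- `‖X‖ ^ q` is at most the term `j = ⌊‖X‖⌋` of the sum over the levels
  have hl : ∫⁻ ω, ENNReal.ofReal (‖X ω‖ ^ q) ∂μ ≤ ENNReal.ofReal S := by
    have hmeas : ∀ j : ℕ, MeasurableSet {ω | (j : ℝ) ≤ ‖X ω‖} := fun j =>
      measurableSet_le measurable_const hX.norm
    calc ∫⁻ ω, ENNReal.ofReal (‖X ω‖ ^ q) ∂μ
        ≤ ∫⁻ ω, ∑' j : ℕ, {ω | (j : ℝ) ≤ ‖X ω‖}.indicator
            (fun _ => ENNReal.ofReal (((j : ℝ) + 1) ^ q)) ω ∂μ := by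
          refine lintegral_mono fun ω => ?_
          refine le_trans ?_ (ENNReal.le_tsum ⌊‖X ω‖⌋₊)
          rw [Set.indicator_of_mem (show ω ∈ {ω' | ((⌊‖X ω‖⌋₊ : ℕ) : ℝ) ≤ ‖X ω'‖} from
            Nat.floor_le (norm_nonneg _))]
          refine ENNReal.ofReal_le_ofReal ?_
          gcongr
          exact (Nat.lt_floor_add_one _).le
      _ = ∑' j : ℕ, ENNReal.ofReal (((j : ℝ) + 1) ^ q) * μ {ω | (j : ℝ) ≤ ‖X ω‖} := by
          rw [lintegral_tsum fun j => (measurable_const.indicator (hmeas j)).aemeasurable]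
          refine tsum_congr fun j => ?_
          rw [lintegral_indicator (hmeas j), lintegral_const, Measure.restrict_apply_univ]
      _ ≤ ∑' j : ℕ, ENNReal.ofReal ((C + 1) * (((j : ℝ) + 1) ^ q * Real.exp (-(j : ℝ) ^ ϑ))) := by
          refine ENNReal.tsum_le_tsum fun j => ?_
          refine (mul_le_mul_right (hlev j) _).trans ?_
          rw [← ENNReal.ofReal_mul (by positivity)]
          exact ENNReal.ofReal_le_ofReal (le_of_eq (by ring))
      _ = _ := by
          rw [hS, ENNReal.ofReal_tsum_of_nonneg (fun j => by positivity) hs]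
  have hint : Integrable (fun ω => ‖X ω‖ ^ q) μ := by
    refine ⟨(hX.norm.pow_const q).aestronglyMeasurable, ?_⟩
    rw [hasFiniteIntegral_iff_ofReal (Filter.Eventually.of_forall fun ω => by positivity)]
    exact hl.trans_lt ENNReal.ofReal_lt_top
  refine ⟨hint, ?_⟩
  rw [integral_eq_lintegral_of_nonneg_ae (Filter.Eventually.of_forall fun ω => by positivity)
    hint.aestronglyMeasurable]
  exact ENNReal.toReal_le_of_le_ofReal (tsum_nonneg fun j => by positivity) hl

end Moments

/-! ### Measurability -/

section Measurability

variable {α : Type*} [MeasurableSpace α] {N : ℕ}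

lemma measurable_det {n : Type*} [Fintype n] [DecidableEq n] {M : α → Matrix n n ℂ}
    (hM : ∀ i j, Measurable fun a => M a i j) : Measurable fun a => (M a).det := by
  simp_rw [Matrix.det_apply]
  exact Finset.measurable_fun_sum _ fun σ _ =>
    (Finset.measurable_fun_prod _ fun i _ => hM _ _).const_smul _

lemma measurable_green_apply {M : α → Matrix (Fin N) (Fin N) ℂ}
    (hM : ∀ i j, Measurable fun a => M a i j) (z : ℂ) (k l : Fin N) :
    Measurable fun a => green (M a) z k l := by
  have h : ∀ i j, Measurable fun a => (M a - z • (1 : Matrix (Fin N) (Fin N) ℂ)) i j :=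
    fun i j => (hM i j).sub measurable_const
  simp_rw [green, Matrix.inv_def, Ring.inverse_eq_inv', Matrix.smul_apply, Matrix.adjugate_apply]
  refine (measurable_det h).inv.smul (measurable_det fun i j => ?_)
  by_cases hi : i = l
  · subst hi; simp only [Matrix.updateRow_self]; exact measurable_const
  · simp only [Matrix.updateRow_ne hi]; exact h i j

lemma measurable_greenTraces {n : ℕ} {k : Fin n → ℕ} (z : (m : Fin n) → Fin (k m) → ℂ)
    {M : α → Matrix (Fin N) (Fin N) ℂ} (hM : ∀ i j, Measurable fun a => M a i j) :
    Measurable fun a => greenTraces z (M a) := by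
  have key : ∀ (k : ℕ) (z : Fin k → ℂ) (p q : Fin N),
      Measurable fun a => (List.ofFn fun j => green (M a) (z j)).prod p q := by
    intro k
    induction k with
    | zero => intro z p q; simp only [List.ofFn_zero, List.prod_nil]; exact measurable_const
    | succ k ih =>
      intro z p q
      simp_rw [List.ofFn_succ, List.prod_cons, Matrix.mul_apply]
      exact Finset.measurable_fun_sum _ fun m _ =>
        (measurable_green_apply hM _ _ _).mul (ih _ _ _)
  refine measurable_pi_lambda _ fun m => ?_
  exact (Finset.measurable_fun_sum _ fun p _ => key _ _ p p).const_mul _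

end Measurability

/-! ### Replacing one independent variable -/

section Replace

universe u

variable {Ω : Type u} [MeasurableSpace Ω] {μ : Measure Ω} [IsProbabilityMeasure μ]

/-- Fubini's theorem for functions of two independent variables. -/
lemma integral_comp_eq_of_indepFun {S : Type*} [MeasurableSpace S] {Q : Ω → S} {X : Ω → ℂ}
    (hQ : Measurable Q) (hX : Measurable X) (hind : IndepFun Q X μ) {f : S × ℂ → ℂ}
    (hf : Measurable f) {c : ℝ} (hc : ∀ ω x, ‖f (Q ω, x)‖ ≤ c) :
    (Integrable (fun ω => ∫ x, f (Q ω, x) ∂(μ.map X)) μ) ∧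
    ∫ ω, f (Q ω, X ω) ∂μ = ∫ ω, ∫ x, f (Q ω, x) ∂(μ.map X) ∂μ := by
  have hXp : IsProbabilityMeasure (μ.map X) := Measure.isProbabilityMeasure_map hX.aemeasurable
  have hQp : IsProbabilityMeasure (μ.map Q) := Measure.isProbabilityMeasure_map hQ.aemeasurable
  have hprod := (indepFun_iff_map_prod_eq_prod_map_map hQ.aemeasurable hX.aemeasurable).1 hind
  have hi : Integrable f ((μ.map Q).prod (μ.map X)) := by
    rw [← hprod, integrable_map_measure hf.aestronglyMeasurable (hQ.prodMk hX).aemeasurable]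
    exact (integrable_const c).mono' (hf.comp (hQ.prodMk hX)).aestronglyMeasurable
      (Filter.Eventually.of_forall fun ω => hc ω _)
  have hg := hi.integral_prod_left
  refine ⟨(integrable_map_measure hg.aestronglyMeasurable hQ.aemeasurable).1 hg, ?_⟩
  calc ∫ ω, f (Q ω, X ω) ∂μ = ∫ y, f y ∂(μ.map fun ω => (Q ω, X ω)) :=
        (integral_map (hQ.prodMk hX).aemeasurable hf.aestronglyMeasurable).symm
    _ = ∫ q, ∫ x, f (q, x) ∂(μ.map X) ∂(μ.map Q) := by rw [hprod, integral_prod f hi]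
    _ = _ := integral_map hQ.aemeasurable hg.aestronglyMeasurable

/-- Conditioning on the variable `Q`: the expectations of `f (Q, X)` and `f (Q, Y)` differ by at
most the difference of the conditional expectations outside an exceptional event, on which only
the boundedness of `f` is used. -/
lemma norm_integral_sub_le_of_indepFun {S : Type*} [MeasurableSpace S] {Q : Ω → S} {X Y : Ω → ℂ}
    (hQ : Measurable Q) (hX : Measurable X) (hY : Measurable Y) (hindX : IndepFun Q X μ)
    (hindY : IndepFun Q Y μ) {f : S × ℂ → ℂ} (hf : Measurable f) {c₀ : ℂ} {c s : ℝ}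
    (hc : ∀ ω x, ‖f (Q ω, x) - c₀‖ ≤ c) (hs : 0 ≤ s) {bad : Set Ω} (hbad : MeasurableSet bad)
    (hgood : ∀ ω ∉ bad, ‖(∫ x, f (Q ω, x) ∂(μ.map X)) - ∫ x, f (Q ω, x) ∂(μ.map Y)‖ ≤ s) :
    ‖(∫ ω, f (Q ω, X ω) ∂μ) - ∫ ω, f (Q ω, Y ω) ∂μ‖ ≤ s + 2 * c * μ.real bad := by
  have hXp : IsProbabilityMeasure (μ.map X) := Measure.isProbabilityMeasure_map hX.aemeasurable
  have hYp : IsProbabilityMeasure (μ.map Y) := Measure.isProbabilityMeasure_map hY.aemeasurable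
  have hc' : ∀ ω x, ‖f (Q ω, x)‖ ≤ c + ‖c₀‖ := fun ω x => by
    have := norm_add_le (f (Q ω, x) - c₀) c₀
    rw [sub_add_cancel] at this
    linarith [hc ω x]
  obtain ⟨iX, eX⟩ := integral_comp_eq_of_indepFun hQ hX hindX hf hc'
  obtain ⟨iY, eY⟩ := integral_comp_eq_of_indepFun hQ hY hindY hf hc'
  rw [eX, eY, ← integral_sub iX iY]
  have hdev : ∀ (σ : Measure ℂ) [IsProbabilityMeasure σ] (ω : Ω),
      ‖(∫ x, f (Q ω, x) ∂σ) - c₀‖ ≤ c := by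
    intro σ _ ω
    have hi : Integrable (fun x => f (Q ω, x)) σ :=
      (integrable_const (c + ‖c₀‖)).mono' (hf.comp measurable_prodMk_left).aestronglyMeasurable
        (Filter.Eventually.of_forall fun x => hc' ω x)
    have e : (∫ x, f (Q ω, x) ∂σ) - c₀ = ∫ x, (f (Q ω, x) - c₀) ∂σ := by
      rw [integral_sub hi (integrable_const _), integral_const, probReal_univ, one_smul]
    rw [e]
    have := norm_integral_le_of_norm_le_const (μ := σ)
      (Filter.Eventually.of_forall fun x => hc ω x)
    simpa using this
  have hc0 : ∀ ω : Ω, 0 ≤ c := fun ω => (norm_nonneg _).trans (hc ω 0)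
  have hpt : ∀ ω, ‖(∫ x, f (Q ω, x) ∂(μ.map X)) - ∫ x, f (Q ω, x) ∂(μ.map Y)‖ ≤
      s + bad.indicator (fun _ => 2 * c) ω := by
    intro ω
    by_cases h : ω ∈ bad
    · rw [Set.indicator_of_mem h]
      have h1 := hdev (μ.map X) ω
      have h2 := hdev (μ.map Y) ω
      have h3 := norm_sub_le ((∫ x, f (Q ω, x) ∂(μ.map X)) - c₀)
        ((∫ x, f (Q ω, x) ∂(μ.map Y)) - c₀)
      rw [sub_sub_sub_cancel_right] at h3
      linarith
    · rw [Set.indicator_of_notMem h, add_zero]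
      exact hgood ω h
  have hind : Integrable (bad.indicator fun _ => 2 * c) μ :=
    (integrable_const _).indicator hbad
  refine (norm_integral_le_of_norm_le ((integrable_const s).add hind)
    (Filter.Eventually.of_forall hpt)).trans (le_of_eq ?_)
  rw [integral_add' (integrable_const s) hind, integral_indicator_const _ hbad, integral_const,
    probReal_univ, one_smul, smul_eq_mul, mul_comm (μ.real bad)]

end Replace

/-! ### The interpolating matrices -/

section Interpolate

variable {N : ℕ}

/-- The matrix `M` with the entries `(i, j)` and `(j, i)` set to zero, where `p = (i, j)`. -/
def eraseEntry (p : UpperIdx N) (M : Matrix (Fin N) (Fin N) ℂ) : Matrix (Fin N) (Fin N) ℂ :=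
  Matrix.of fun a b => if upperIdx a b = p then 0 else M a b

/-- The factor that makes up for the two summands of `entryPert` falling on the same entry when
`p` is on the diagonal. -/
noncomputable def diagFactor (p : UpperIdx N) : ℝ := if p.1.1 = p.1.2 then 1 / 2 else 1

lemma upperIdx_comm (a b : Fin N) : upperIdx a b = upperIdx b a := by
  simp [upperIdx, min_comm, max_comm]

lemma upperIdx_eq_iff (a b : Fin N) (p : UpperIdx N) :
    upperIdx a b = p ↔ (a = p.1.1 ∧ b = p.1.2) ∨ (a = p.1.2 ∧ b = p.1.1) := by
  obtain ⟨⟨i, j⟩, hij⟩ := p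
  simp only [upperIdx, Subtype.mk.injEq, Prod.mk.injEq]
  simp only at hij
  constructor
  · rintro ⟨rfl, rfl⟩
    rcases le_total a b with h | h <;> simp [h]
  · rintro (⟨rfl, rfl⟩ | ⟨rfl, rfl⟩) <;> simp [hij]

lemma isHermitian_eraseEntry (p : UpperIdx N) {M : Matrix (Fin N) (Fin N) ℂ}
    (hM : M.IsHermitian) : (eraseEntry p M).IsHermitian := by
  refine Matrix.IsHermitian.ext fun a b => ?_
  simp only [eraseEntry, Matrix.of_apply, upperIdx_comm b a]
  split_ifs
  · simp
  · exact hM.apply a b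

lemma eraseEntry_add_entryPert (p : UpperIdx N) {M : Matrix (Fin N) (Fin N) ℂ}
    (hM : M.IsHermitian) :
    eraseEntry p M + entryPert p.1.1 p.1.2 (diagFactor p * M p.1.1 p.1.2) = M := by
  ext a b
  have hconj : starRingEnd ℂ (M p.1.1 p.1.2) = M p.1.2 p.1.1 := hM.apply _ _
  simp only [eraseEntry, Matrix.add_apply, Matrix.of_apply, entryPert, Matrix.single_apply,
    upperIdx_eq_iff, diagFactor, map_mul, Complex.conj_ofReal, hconj]
  by_cases hd : p.1.1 = p.1.2
  · rw [← hd]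
    by_cases ha : a = p.1.1 <;> by_cases hb : b = p.1.1 <;> simp [ha, hb, eq_comm]
    ring_nf
  · by_cases h1 : a = p.1.1 ∧ b = p.1.2
    · obtain ⟨rfl, rfl⟩ := h1
      simp [hd, eq_comm]
    · by_cases h2 : a = p.1.2 ∧ b = p.1.1
      · obtain ⟨rfl, rfl⟩ := h2
        simp [hd, eq_comm]
      · have h1' : ¬ (p.1.1 = a ∧ p.1.2 = b) := fun h => h1 ⟨h.1.symm, h.2.symm⟩
        have h2' : ¬ (p.1.2 = a ∧ p.1.1 = b) := fun h => h2 ⟨h.1.symm, h.2.symm⟩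
        simp [h1, h2, h1', h2']

variable (φ : UpperIdx N ≃ Finset.Icc 1 (N * (N + 1) / 2)) {A B : Matrix (Fin N) (Fin N) ℂ}

lemma isHermitian_interpolate (γ : ℕ) (hA : A.IsHermitian) (hB : B.IsHermitian) :
    (interpolate φ γ A B).IsHermitian := by
  refine Matrix.IsHermitian.ext fun a b => ?_
  simp only [interpolate, Matrix.of_apply, upperIdx_comm b a]
  split_ifs
  · exact hB.apply a b
  · exact hA.apply a b

lemma interpolate_zero : interpolate φ 0 A B = A := by
  ext a b
  have h := (Finset.mem_Icc.1 (φ (upperIdx a b)).2).1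
  simp only [interpolate, Matrix.of_apply]
  rw [if_neg (by omega)]

lemma interpolate_card : interpolate φ (N * (N + 1) / 2) A B = B := by
  ext a b
  have h := (Finset.mem_Icc.1 (φ (upperIdx a b)).2).2
  simp only [interpolate, Matrix.of_apply]
  rw [if_pos h]

/-- Two consecutive interpolating matrices differ in a single entry. -/
lemma eraseEntry_interpolate_succ {γ : ℕ} {p : UpperIdx N} (hp : (φ p : ℕ) = γ + 1) :
    eraseEntry p (interpolate φ γ A B) = eraseEntry p (interpolate φ (γ + 1) A B) := by
  ext a b
  simp only [eraseEntry, interpolate, Matrix.of_apply]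
  split_ifs with h1 h2 h3 h3
  · rfl
  · rfl
  · omega
  · refine absurd ?_ h1
    refine φ.injective (Subtype.ext ?_)
    omega
  · rfl

lemma interpolate_apply_of_le {γ : ℕ} {p : UpperIdx N} (hp : (φ p : ℕ) ≤ γ) :
    interpolate φ γ A B p.1.1 p.1.2 = B p.1.1 p.1.2 := by
  have : upperIdx p.1.1 p.1.2 = p := (upperIdx_eq_iff _ _ _).2 (Or.inl ⟨rfl, rfl⟩)
  simp only [interpolate, Matrix.of_apply, this, if_pos hp]

lemma interpolate_apply_of_lt {γ : ℕ} {p : UpperIdx N} (hp : γ < (φ p : ℕ)) :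
    interpolate φ γ A B p.1.1 p.1.2 = A p.1.1 p.1.2 := by
  have : upperIdx p.1.1 p.1.2 = p := (upperIdx_eq_iff _ _ _).2 (Or.inl ⟨rfl, rfl⟩)
  simp only [interpolate, Matrix.of_apply, this, if_neg (not_le.2 hp)]

/-- The common part of two consecutive interpolating matrices is a function of the pairs of entries
other than `p`, and so independent of the pair at `p`. -/
lemma indepFun_eraseEntry_interpolate {Ω : Type*} [MeasurableSpace Ω] {μ : Measure Ω}
    {A B : Ω → Matrix (Fin N) (Fin N) ℂ} {r : ℝ} {v w : Ω → Matrix (Fin N) (Fin N) ℂ}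
    (hA : ∀ ω, (A ω).IsHermitian) (hB : ∀ ω, (B ω).IsHermitian)
    (hAv : ∀ ω a b, A ω a b = r * v ω a b) (hBw : ∀ ω a b, B ω a b = r * w ω a b)
    (hv : ∀ a b, Measurable fun ω => v ω a b) (hw : ∀ a b, Measurable fun ω => w ω a b)
    (hind : iIndepFun (fun (p : UpperIdx N) ω => (v ω p.1.1 p.1.2, w ω p.1.1 p.1.2)) μ)
    (γ : ℕ) (p : UpperIdx N) :
    IndepFun (fun ω (a b : Fin N) => eraseEntry p (interpolate φ γ (A ω) (B ω)) a b)
      (fun ω => (v ω p.1.1 p.1.2, w ω p.1.1 p.1.2)) μ := by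
  classical
  have h := hind.indepFun_finset (Finset.univ.erase p) {p}
    (by simp) fun q => (hv _ _).prodMk (hw _ _)
  let ψ : ({q // q ∈ Finset.univ.erase p} → ℂ × ℂ) → Fin N → Fin N → ℂ :=
    fun t a b => if hq : upperIdx a b ∈ Finset.univ.erase p then
      (let x := if (φ (upperIdx a b) : ℕ) ≤ γ then (t ⟨_, hq⟩).2 else (t ⟨_, hq⟩).1
       r * if a ≤ b then x else starRingEnd ℂ x) else 0
  have hψ : Measurable ψ := by
    refine measurable_pi_lambda _ fun a => measurable_pi_lambda _ fun b => ?_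
    by_cases hq : upperIdx a b ∈ Finset.univ.erase p
    · simp only [ψ, dif_pos hq]
      have hx : Measurable fun t : {q // q ∈ Finset.univ.erase p} → ℂ × ℂ =>
          if (φ (upperIdx a b) : ℕ) ≤ γ then (t ⟨_, hq⟩).2 else (t ⟨_, hq⟩).1 := by
        split_ifs
        · exact (measurable_pi_apply _).snd
        · exact (measurable_pi_apply _).fst
      by_cases hab : a ≤ b
      · simp only [if_pos hab]; exact hx.const_mul _
      · simp only [if_neg hab]
        exact (Complex.continuous_conj.measurable.comp hx).const_mul _
    · simp only [ψ, dif_neg hq]; exact measurable_const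
  let e : ({q // q ∈ ({p} : Finset (UpperIdx N))} → ℂ × ℂ) → ℂ × ℂ :=
    fun t => t ⟨p, Finset.mem_singleton_self p⟩
  have h2 := h.comp hψ (measurable_pi_apply (⟨p, Finset.mem_singleton_self p⟩ :
    {q // q ∈ ({p} : Finset (UpperIdx N))}) : Measurable e)
  refine h2.congr ?_ ?_
  · refine Filter.Eventually.of_forall fun ω => ?_
    funext a b
    simp only [Function.comp, ψ, Finset.mem_erase, Finset.mem_univ, and_true, eraseEntry,
      interpolate, Matrix.of_apply]
    by_cases hq : upperIdx a b = p
    · simp [hq]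
    · simp only [hq, not_false_eq_true, if_false, ne_eq, dite_true]
      rcases le_or_gt a b with hab | hab
      · simp only [upperIdx, min_eq_left hab, max_eq_right hab, if_pos hab]
        split_ifs
        · exact (hBw _ _ _).symm
        · exact (hAv _ _ _).symm
      · simp only [upperIdx, min_eq_right hab.le, max_eq_left hab.le, if_neg (not_le.2 hab)]
        split_ifs
        · rw [← (hB ω).apply a b, hBw]; simp
        · rw [← (hA ω).apply a b, hAv]; simp
  · exact Filter.Eventually.of_forall fun ω => rfl

end Interpolate

/-! ### Replacing one entry of the matrix -/

section Step

universe u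

lemma normalized_apply {N : ℕ} (v : Matrix (Fin N) (Fin N) ℂ) (a b : Fin N) :
    normalized v a b = ((√(N : ℝ))⁻¹ : ℝ) * v a b := by
  simp [normalized]

/-- The linear map that turns the unnormalized entry `p` into the parameter of `entryPert`. -/
noncomputable def entryScale {N : ℕ} (p : UpperIdx N) : ℂ →L[ℝ] ℂ :=
  ((√(N : ℝ))⁻¹ * diagFactor p) • ContinuousLinearMap.id ℝ ℂ

lemma entryScale_apply {N : ℕ} (p : UpperIdx N) (x : ℂ) :
    entryScale p x = diagFactor p * (((√(N : ℝ))⁻¹ : ℝ) * x) := by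
  simp only [entryScale, FunLike.coe_smul, Pi.smul_apply, ContinuousLinearMap.coe_id',
    id_eq, Complex.real_smul]
  push_cast
  ring

lemma norm_entryScale_le {N : ℕ} (p : UpperIdx N) : ‖entryScale p‖ ≤ (√(N : ℝ))⁻¹ := by
  have h : |diagFactor p| ≤ 1 := by
    unfold diagFactor
    split_ifs <;> norm_num [abs_of_pos]
  refine ContinuousLinearMap.opNorm_le_bound _ (by positivity) fun x => ?_
  rw [entryScale_apply, norm_mul, norm_mul, Complex.norm_real, Complex.norm_real,
    Real.norm_of_nonneg (show 0 ≤ (√(N : ℝ))⁻¹ by positivity), Real.norm_eq_abs]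
  have : 0 ≤ (√(N : ℝ))⁻¹ * ‖x‖ := by positivity
  nlinarith

variable {Ω : Type u} [MeasurableSpace Ω] {μ : Measure Ω}
  {N : ℕ} {v w : Ω → Matrix (Fin N) (Fin N) ℂ}

/-- The event that some resolvent entry of `H ω` at one of the points `z` exceeds `Γ`. -/
def largeGreen {n : ℕ} {k : Fin n → ℕ} (H : Ω → Matrix (Fin N) (Fin N) ℂ)
    (z : (m : Fin n) → Fin (k m) → ℂ) (Γ : ℝ) : Set Ω :=
  {ω | ∃ m a p q, Γ < ‖green (H ω) (z m a) p q‖}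

lemma measurableSet_largeGreen {n : ℕ} {k : Fin n → ℕ} {H : Ω → Matrix (Fin N) (Fin N) ℂ}
    (hH : ∀ a b, Measurable fun ω => H ω a b) (z : (m : Fin n) → Fin (k m) → ℂ) (Γ : ℝ) :
    MeasurableSet (largeGreen H z Γ) := by
  simp only [largeGreen, Set.ofPred_exists]
  exact MeasurableSet.iUnion fun m => MeasurableSet.iUnion fun a => MeasurableSet.iUnion fun p =>
    MeasurableSet.iUnion fun q =>
      measurableSet_lt measurable_const (measurable_green_apply hH _ _ _).norm

lemma measurable_interpolate {φ : UpperIdx N ≃ Finset.Icc 1 (N * (N + 1) / 2)}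
    (hv : ∀ a b, Measurable fun ω => v ω a b) (hw : ∀ a b, Measurable fun ω => w ω a b) (γ : ℕ)
    (a b : Fin N) :
    Measurable fun ω => interpolate φ γ (normalized (v ω)) (normalized (w ω)) a b := by
  simp only [interpolate, Matrix.of_apply, normalized_apply]
  split_ifs
  · exact (hw a b).const_mul _
  · exact (hv a b).const_mul _

lemma measurable_entryPert_apply {α : Type*} [MeasurableSpace α] {i j : Fin N} {x : α → ℂ}
    (hx : Measurable x) (a b : Fin N) : Measurable fun ω => entryPert i j (x ω) a b := by
  simp only [entryPert, Matrix.add_apply, Matrix.single_apply]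
  refine Measurable.add ?_ ?_
  · split_ifs
    · exact hx
    · exact measurable_const
  · split_ifs
    · exact Complex.continuous_conj.measurable.comp hx
    · exact measurable_const

/-- The effect of replacing a single entry. The fourth order term carries the moment difference
`m`; the last term accounts for the events on which the resolvent or the entry is large. -/
theorem norm_integral_interpolate_succ_sub_le [IsProbabilityMeasure μ]
    {φ : UpperIdx N ≃ Finset.Icc 1 (N * (N + 1) / 2)} {γ : ℕ} (hγ : γ < N * (N + 1) / 2)
    (hv : ∀ a b, Measurable fun ω => v ω a b) (hw : ∀ a b, Measurable fun ω => w ω a b)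
    (hvH : ∀ ω, (normalized (v ω)).IsHermitian) (hwH : ∀ ω, (normalized (w ω)).IsHermitian)
    (hind : iIndepFun (fun (p : UpperIdx N) ω => (v ω p.1.1 p.1.2, w ω p.1.1 p.1.2)) μ)
    {n K : ℕ} {k : Fin n → ℕ} (hk : ∀ m, 0 < k m) (hK : ∑ m, k m = K)
    {z : (m : Fin n) → Fin (k m) → ℂ} {η : ℝ} (hη : 0 < η) (hη1 : η ≤ 1)
    (hz : ∀ m a, |(z m a).im| = η) {F : (Fin n → ℂ) → ℂ} (hF : ContDiff ℝ 5 F)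
    {R Γ B B' A m c δ δ' : ℝ} {c₀ : ℂ} {r : ℕ} (hR : 0 < R) (hΓ : 1 ≤ Γ)
    (hsmall : 8 * (√(N : ℝ))⁻¹ * R * Γ ≤ 1) (hB0 : 0 ≤ B) (hB0' : 0 ≤ B')
    (hB : ∀ y : Fin n → ℂ, (∀ s, ‖y s‖ ≤ (4 * Γ) ^ k s) → PartialsBoundedAt F y B)
    (hB' : ∀ H : Matrix (Fin N) (Fin N) ℂ, H.IsHermitian →
      PartialsBoundedAt F (greenTraces z H) B')
    (hc : ∀ H : Matrix (Fin N) (Fin N) ℂ, H.IsHermitian → ‖F (greenTraces z H) - c₀‖ ≤ c)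
    (hvi : ∀ a b, ∀ q : ℕ, Integrable (fun ω => ‖v ω a b‖ ^ q) μ)
    (hwi : ∀ a b, ∀ q : ℕ, Integrable (fun ω => ‖w ω a b‖ ^ q) μ)
    (hvA : ∀ a b, ∫ ω, ‖v ω a b‖ ^ (5 + r) ∂μ ≤ A)
    (hwA : ∀ a b, ∫ ω, ‖w ω a b‖ ^ (5 + r) ∂μ ≤ A)
    (hm3 : ∀ i j, ∀ s u : ℕ, s + u ≤ 3 → entryMoment μ v i j s u = entryMoment μ w i j s u)
    (hm4 : ∀ i j, ∀ s : ℕ, s ≤ 4 →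
      ‖entryMoment μ v i j s (4 - s) - entryMoment μ w i j s (4 - s)‖ ≤ m)
    (hδ : μ.real (largeGreen (fun ω => interpolate φ (γ + 1) (normalized (v ω))
      (normalized (w ω))) z Γ) ≤ δ)
    (hδ' : ∀ a b, μ.real {ω | R < ‖w ω a b‖} ≤ δ') :
    ‖(∫ ω, F (greenTraces z (interpolate φ γ (normalized (v ω)) (normalized (w ω)))) ∂μ) -
      ∫ ω, F (greenTraces z (interpolate φ (γ + 1) (normalized (v ω)) (normalized (w ω)))) ∂μ‖ ≤
    24 * ((2 * K + 1) ^ 5 * B) * (240 * K * (√(N : ℝ))⁻¹ * (4 * Γ) ^ (K + 1)) ^ 4 * m +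
      2 * (120 * ((2 * K + 1) ^ 5 * B) * (240 * K * (√(N : ℝ))⁻¹ * (4 * Γ) ^ (K + 1)) ^ 5 * R ^ 5 +
        120 * ((2 * K + 1) ^ 5 * B') * (240 * K * (√(N : ℝ))⁻¹ * η⁻¹ ^ (K + 1)) ^ 5 * A / R ^ r) +
      2 * c * (δ + δ') := by
  obtain ⟨p, hp⟩ : ∃ p, (φ p : ℕ) = γ + 1 :=
    ⟨φ.symm ⟨γ + 1, Finset.mem_Icc.2 ⟨by omega, by omega⟩⟩, by simp⟩
  set b := (√(N : ℝ))⁻¹ with hb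
  have hb0 : 0 ≤ b := by positivity
  set L := entryScale p with hLdef
  have hL : ‖L‖ ≤ b := norm_entryScale_le p
  have hz0 : ∀ s a, (z s a).im ≠ 0 := fun s a h => by
    have := hz s a
    rw [h, abs_zero] at this
    exact hη.ne this
  set H : ℕ → Ω → Matrix (Fin N) (Fin N) ℂ := fun γ ω =>
    interpolate φ γ (normalized (v ω)) (normalized (w ω)) with hHdef
  have hH : ∀ γ ω, (H γ ω).IsHermitian := fun γ ω => isHermitian_interpolate φ γ (hvH ω) (hwH ω)
  set Q : Ω → Fin N → Fin N → ℂ := fun ω a b => eraseEntry p (H γ ω) a b with hQdef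
  have hQH : ∀ ω, (Matrix.of (Q ω)).IsHermitian := fun ω => isHermitian_eraseEntry p (hH γ ω)
  set X : Ω → ℂ := fun ω => v ω p.1.1 p.1.2
  set Y : Ω → ℂ := fun ω => w ω p.1.1 p.1.2
  have hX : Measurable X := hv _ _
  have hY : Measurable Y := hw _ _
  have hQm : Measurable Q := by
    refine measurable_pi_lambda _ fun a => measurable_pi_lambda _ fun b => ?_
    simp only [hQdef, eraseEntry, Matrix.of_apply]
    split_ifs
    · exact measurable_const
    · exact measurable_interpolate hv hw γ a b
  have hindep := indepFun_eraseEntry_interpolate φ hvH hwH (fun ω => normalized_apply (v ω))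
    (fun ω => normalized_apply (w ω)) hv hw hind γ p
  have hindX : IndepFun Q X μ := hindep.comp measurable_id measurable_fst
  have hindY : IndepFun Q Y μ := hindep.comp measurable_id measurable_snd
  have hHX : ∀ ω, H γ ω = Matrix.of (Q ω) + entryPert p.1.1 p.1.2 (L (X ω)) := by
    intro ω
    have h := eraseEntry_add_entryPert p (hH γ ω)
    rw [show H γ ω p.1.1 p.1.2 = ((√(N : ℝ))⁻¹ : ℝ) * v ω p.1.1 p.1.2 by
      rw [← normalized_apply]; exact interpolate_apply_of_lt φ (by omega), ← entryScale_apply] at h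
    exact h.symm
  have hHY : ∀ ω, H (γ + 1) ω = Matrix.of (Q ω) + entryPert p.1.1 p.1.2 (L (Y ω)) := by
    intro ω
    have h := eraseEntry_add_entryPert p (hH (γ + 1) ω)
    rw [show H (γ + 1) ω p.1.1 p.1.2 = ((√(N : ℝ))⁻¹ : ℝ) * w ω p.1.1 p.1.2 by
      rw [← normalized_apply]; exact interpolate_apply_of_le φ (by omega), ← entryScale_apply,
      ← eraseEntry_interpolate_succ φ hp] at h
    exact h.symm
  set f : (Fin N → Fin N → ℂ) × ℂ → ℂ := fun y =>
    F (greenTraces z (Matrix.of y.1 + entryPert p.1.1 p.1.2 (L y.2))) with hfdef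
  have hf : Measurable f := by
    refine hF.continuous.measurable.comp (measurable_greenTraces z fun a b => ?_)
    exact Measurable.add (f := fun y : (Fin N → Fin N → ℂ) × ℂ => y.1 a b)
      (g := fun y => entryPert p.1.1 p.1.2 (L y.2) a b)
      ((measurable_pi_apply b).comp ((measurable_pi_apply a).comp measurable_fst))
      (measurable_entryPert_apply (L.continuous.measurable.comp measurable_snd) a b)
  have hPH : ∀ ω x, (Matrix.of (Q ω) + entryPert p.1.1 p.1.2 (L x)).IsHermitian := fun ω x =>
    (hQH ω).add (isHermitian_entryPert _)
  -- Outside this event the resolvent of the common part `Q` is bounded: it arises from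
  -- `H (γ + 1)` by removing the small entry `Y`. The expansion takes place around `Q`, so the
  -- entry `X` need not be small.
  set bad : Set Ω := largeGreen (H (γ + 1)) z Γ ∪ {ω | R < ‖Y ω‖} with hbaddef
  have hbad : MeasurableSet bad :=
    (measurableSet_largeGreen (measurable_interpolate hv hw _) z Γ).union
      (measurableSet_lt measurable_const hY.norm)
  have hbadm : μ.real bad ≤ δ + δ' :=
    (measureReal_union_le _ _).trans (add_le_add hδ (hδ' _ _))
  have hXp : IsProbabilityMeasure (μ.map X) := Measure.isProbabilityMeasure_map hX.aemeasurable
  have hYp : IsProbabilityMeasure (μ.map Y) := Measure.isProbabilityMeasure_map hY.aemeasurable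
  have hcont : ∀ s u : ℕ, Continuous fun x : ℂ => (starRingEnd ℂ x) ^ s * x ^ u := fun s u => by
    have := Complex.continuous_conj
    fun_prop
  have hmX : ∀ s u : ℕ, ∫ x, (starRingEnd ℂ x) ^ s * x ^ u ∂(μ.map X) =
      entryMoment μ v p.1.1 p.1.2 s u := fun s u =>
    integral_map hX.aemeasurable (hcont s u).aestronglyMeasurable
  have hmY : ∀ s u : ℕ, ∫ x, (starRingEnd ℂ x) ^ s * x ^ u ∂(μ.map Y) =
      entryMoment μ w p.1.1 p.1.2 s u := fun s u =>
    integral_map hY.aemeasurable (hcont s u).aestronglyMeasurable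
  have hcn : ∀ q : ℕ, Continuous fun x : ℂ => ‖x‖ ^ q := fun q => by fun_prop
  have hA0 : 0 ≤ A := (integral_nonneg fun ω => by positivity).trans (hvA p.1.1 p.1.2)
  have hm0 : 0 ≤ m := (norm_nonneg _).trans (hm4 p.1.1 p.1.2 0 (Nat.zero_le _))
  have hgood : ∀ ω ∉ bad, ‖(∫ x, f (Q ω, x) ∂(μ.map X)) - ∫ x, f (Q ω, x) ∂(μ.map Y)‖ ≤
      24 * ((2 * K + 1) ^ 5 * B) * (240 * K * b * (4 * Γ) ^ (K + 1)) ^ 4 * m +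
      2 * (120 * ((2 * K + 1) ^ 5 * B) * (240 * K * b * (4 * Γ) ^ (K + 1)) ^ 5 * R ^ 5 +
        120 * ((2 * K + 1) ^ 5 * B') * (240 * K * b * η⁻¹ ^ (K + 1)) ^ 5 * A / R ^ r) := by
    intro ω hω
    simp only [hbaddef, Set.mem_union, not_or, largeGreen, Set.mem_ofPred_eq, not_exists,
      not_lt] at hω
    obtain ⟨hω1, hω2⟩ := hω
    have hLn : ∀ x : ℂ, ‖x‖ ≤ R → ‖L x‖ ≤ b * R := fun x hx =>
      (L.le_of_opNorm_le hL x).trans (by gcongr)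
    -- the matrix without the entry `p` is a small perturbation of the next matrix
    have hQ2 : ∀ s a k l, ‖green (Matrix.of (Q ω)) (z s a) k l‖ ≤ 2 * Γ := by
      intro s a k l
      have h := norm_green_add_entryPert_le (i := p.1.1) (j := p.1.2) (a := -L (Y ω))
        (hH (γ + 1) ω) (hz0 s a) (hω1 s a) (by
          rw [norm_neg]
          have := hLn _ hω2
          calc 4 * ‖L (Y ω)‖ * Γ ≤ 4 * (b * R) * Γ := by gcongr
            _ ≤ 1 := by nlinarith [show 0 ≤ b * R * Γ by positivity]) k l
      rwa [show H (γ + 1) ω + entryPert p.1.1 p.1.2 (-L (Y ω)) = Matrix.of (Q ω) by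
        rw [hHY, ← entryPertCLM_apply, ← entryPertCLM_apply, map_neg]; abel] at h
    have hx4 : ∀ x : ℂ, ‖x‖ ≤ R → ∀ s a k l,
        ‖green (Matrix.of (Q ω) + entryPert p.1.1 p.1.2 (L x)) (z s a) k l‖ ≤ 4 * Γ := by
      intro x hx s a k l
      have h := norm_green_add_entryPert_le (i := p.1.1) (j := p.1.2) (a := L x)
        (hQH ω) (hz0 s a) (hQ2 s a) (by
          have := hLn _ hx
          calc 4 * ‖L x‖ * (2 * Γ) ≤ 4 * (b * R) * (2 * Γ) := by gcongr
            _ ≤ 1 := by linarith) k l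
      linarith
    have hD : ∀ x : ℂ, ‖x‖ ≤ R → ∀ a : ℕ, 1 ≤ a → a ≤ 5 →
        ‖iteratedFDeriv ℝ a (fun x => f (Q ω, x)) x‖ ≤
          a.factorial * ((2 * K + 1) ^ 5 * B) * (240 * K * b * (4 * Γ) ^ (K + 1)) ^ a := by
      intro x hx a ha1 ha5
      refine norm_iteratedFDeriv_comp_greenTraces_le hk hK hz0 hF (hQH ω) hL (by linarith)
        (hx4 x hx) (hB _ fun s => ?_) hB0 ha1 ha5
      exact norm_greenTraces_apply_le hk hz0 (hPH ω x) p.1.1 (hx4 x hx) s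
    have hD' : ∀ x : ℂ, ‖iteratedFDeriv ℝ 5 (fun x => f (Q ω, x)) x‖ ≤
          120 * ((2 * K + 1) ^ 5 * B') * (240 * K * b * η⁻¹ ^ (K + 1)) ^ 5 := by
      intro x
      exact norm_iteratedFDeriv_comp_greenTraces_le (a := 5) hk hK hz0 hF (hQH ω) hL
        ((one_le_inv₀ hη).2 hη1) (fun s a k l => by
          rw [← hz s a]; exact norm_green_apply_le (hPH ω x) (hz0 s a) k l)
        (hB' _ (hPH ω x)) hB0' (by norm_num) le_rfl
    have hfs : ContDiff ℝ 5 fun x => f (Q ω, x) :=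
      hF.comp (contDiff_greenTraces L hk hz0 (hQH ω) 5)
    have hfi : ∀ (σ : Measure ℂ) [IsProbabilityMeasure σ], Integrable (fun x => f (Q ω, x)) σ := by
      intro σ _
      refine (integrable_const (c + ‖c₀‖)).mono' hfs.continuous.aestronglyMeasurable
        (Filter.Eventually.of_forall fun x => ?_)
      have := norm_add_le (f (Q ω, x) - c₀) c₀
      rw [sub_add_cancel] at this
      linarith [hc _ (hPH ω x)]
    refine norm_integral_sub_integral_le hfs r hR ?_ (fun x hx => ?_) hD' ?_ ?_ ?_ ?_ ?_ ?_
      (hfi _) (hfi _)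
    · exact hD 0 (by simpa using hR.le) 4 (by norm_num) (by norm_num)
    · exact hD x hx 5 (by norm_num) le_rfl
    · exact fun q => (integrable_map_measure (hcn q).aestronglyMeasurable hX.aemeasurable).2
        (hvi _ _ q)
    · exact fun q => (integrable_map_measure (hcn q).aestronglyMeasurable hY.aemeasurable).2
        (hwi _ _ q)
    · rw [integral_map hX.aemeasurable (hcn _).aestronglyMeasurable]; exact hvA _ _
    · rw [integral_map hY.aemeasurable (hcn _).aestronglyMeasurable]; exact hwA _ _
    · intro s u hsu; rw [hmX, hmY]; exact hm3 _ _ s u hsu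
    · intro s hs; rw [hmX, hmY]; exact hm4 _ _ s hs
  have hmain := norm_integral_sub_le_of_indepFun hQm hX hY hindX hindY hf (c₀ := c₀) (c := c)
    (fun ω x => hc _ (hPH ω x)) (by positivity) hbad hgood
  have e1 : ∀ ω, F (greenTraces z (H γ ω)) = f (Q ω, X ω) := fun ω => by rw [hHX]
  have e2 : ∀ ω, F (greenTraces z (H (γ + 1) ω)) = f (Q ω, Y ω) := fun ω => by rw [hHY]
  change ‖(∫ ω, F (greenTraces z (H γ ω)) ∂μ) - ∫ ω, F (greenTraces z (H (γ + 1) ω)) ∂μ‖ ≤ _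
  simp_rw [e1, e2]
  have hc0 : 0 ≤ c := (norm_nonneg _).trans (hc 0 Matrix.isHermitian_zero)
  refine hmain.trans (add_le_add le_rfl ?_)
  gcongr

/-- Summation over all entries. -/
lemma norm_integral_sub_le_card_mul {φ : UpperIdx N ≃ Finset.Icc 1 (N * (N + 1) / 2)}
    {h : Matrix (Fin N) (Fin N) ℂ → ℂ} {s : ℝ}
    (hs : ∀ γ < N * (N + 1) / 2,
      ‖(∫ ω, h (interpolate φ γ (normalized (v ω)) (normalized (w ω))) ∂μ) -
        ∫ ω, h (interpolate φ (γ + 1) (normalized (v ω)) (normalized (w ω))) ∂μ‖ ≤ s)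
    (hs0 : 0 ≤ s) :
    ‖(∫ ω, h (normalized (v ω)) ∂μ) - ∫ ω, h (normalized (w ω)) ∂μ‖ ≤ (N : ℝ) ^ 2 * s := by
  have h1 := dist_le_range_sum_of_dist_le (f := fun γ =>
    ∫ ω, h (interpolate φ γ (normalized (v ω)) (normalized (w ω))) ∂μ) (d := fun _ => s)
    (N * (N + 1) / 2) fun {γ} hγ => by rw [dist_eq_norm]; exact hs γ hγ
  simp only [interpolate_zero, interpolate_card, dist_eq_norm, Finset.sum_const,
    Finset.card_range, nsmul_eq_mul] at h1
  refine h1.trans ?_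
  gcongr
  have : N * (N + 1) / 2 ≤ N ^ 2 := by
    refine Nat.div_le_of_le_mul ?_
    nlinarith
  exact_mod_cast this

end Step

/-! ### The resolvent below the scale of the a priori bound -/

section Apriori

lemma abs_im_eq {E η : ℝ} (hη : 0 < η) (s : ℤˣ) {z : ℂ}
    (hz : z = E + ((s : ℤ) : ℂ) * η * Complex.I) : |z.im| = η := by
  subst hz
  rcases Int.units_eq_one_or s with rfl | rfl <;> simp [abs_of_pos hη]

variable {Ω : Type*} [MeasurableSpace Ω] {μ : Measure Ω} [IsProbabilityMeasure μ]
  {N : ℕ} {H : Ω → Matrix (Fin N) (Fin N) ℂ}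

/-- If the diagonal of the resolvent is at most `N ^ (2 ε)` at every height above `N ^ (-1 + ε)`
with high probability, then all its entries are at most `N ^ (5 ε)` at height
`η ≥ N ^ (-1 - ε)`. Only `J ≥ 1 / ε` heights are used, so the exceptional probability is
multiplied by a number that does not depend on `N`. -/
lemma measureReal_largeGreen_le (hN : 1 ≤ N) (hHm : ∀ a b, Measurable fun ω => H ω a b)
    (hH : ∀ ω, (H ω).IsHermitian) {ε ρ η κ : ℝ} (hε : 0 < ε) (hκ : 0 < κ)
    (hap : ∀ y : ℝ, (N : ℝ) ^ (-1 + ε) ≤ y → 1 - ρ ≤ μ.real {ω | ∀ l : Fin N, ∀ E : ℝ,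
      |E| ≤ 2 - κ → ‖green (H ω) (E + y * Complex.I) l l‖ ≤ (N : ℝ) ^ (2 * ε)})
    (hη1 : (N : ℝ) ^ (-1 - ε) ≤ η) (hη2 : η ≤ (N : ℝ) ^ (-1 : ℝ))
    {n : ℕ} {k : Fin n → ℕ} {E : (m : Fin n) → Fin (k m) → ℝ} (hE : ∀ m j, |E m j| ≤ 2 - 2 * κ)
    {sgn : (m : Fin n) → Fin (k m) → ℤˣ} {z : (m : Fin n) → Fin (k m) → ℂ}
    (hz : ∀ m j, z m j = E m j + ((sgn m j : ℤ) : ℂ) * η * Complex.I)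
    {J : ℕ} (hJ : 1 ≤ J * ε) (hJN : (J : ℝ) + 1 ≤ (N : ℝ) ^ ε) :
    μ.real (largeGreen H z ((N : ℝ) ^ (5 * ε))) ≤ J * ρ := by
  have hN1 : (1 : ℝ) ≤ N := by exact_mod_cast hN
  have hN0 : (0 : ℝ) < N := by linarith
  -- the ladder of heights; at and above `y 1 = N ^ (-1 + ε)` the assumption applies
  set y : ℕ → ℝ := fun j => if j = 0 then η else (N : ℝ) ^ (-1 + j * ε) with hy
  have hη0 : 0 < η := lt_of_lt_of_le (by positivity) hη1
  have hy0 : y 0 = η := by simp [hy]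
  have hys : ∀ j, y (j + 1) = (N : ℝ) ^ (-1 + ((j + 1 : ℕ) : ℝ) * ε) := fun j => by simp [hy]
  have hmono : Monotone y := by
    refine monotone_nat_of_le_succ fun j => ?_
    rcases Nat.eq_zero_or_pos j with rfl | hj
    · rw [hy0, hys]
      exact hη2.trans (Real.rpow_le_rpow_of_exponent_le hN1 (by push_cast; linarith))
    · obtain ⟨i, rfl⟩ : ∃ i, j = i + 1 := ⟨j - 1, by omega⟩
      rw [hys, hys]
      exact Real.rpow_le_rpow_of_exponent_le hN1 (by push_cast; linarith)
  have hq : ∀ j < J, y (j + 1) ≤ (N : ℝ) ^ (2 * ε) * y j := by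
    intro j _
    rcases Nat.eq_zero_or_pos j with rfl | hj
    · rw [hy0, hys]
      calc (N : ℝ) ^ (-1 + ((0 + 1 : ℕ) : ℝ) * ε) = (N : ℝ) ^ (2 * ε) * (N : ℝ) ^ (-1 - ε) := by
            rw [← Real.rpow_add hN0]; congr 1; push_cast; ring
        _ ≤ _ := by gcongr
    · obtain ⟨i, rfl⟩ : ∃ i, j = i + 1 := ⟨j - 1, by omega⟩
      rw [hys, hys, ← Real.rpow_add hN0]
      exact Real.rpow_le_rpow_of_exponent_le hN1 (by push_cast; linarith)
  have hyJ : 1 ≤ y J := by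
    obtain ⟨i, rfl⟩ : ∃ i, J = i + 1 := ⟨J - 1, by
      rcases Nat.eq_zero_or_pos J with rfl | h
      · norm_num at hJ
      · omega⟩
    rw [hys]
    exact Real.one_le_rpow hN1 (by linarith)
  set good : ℕ → Set Ω := fun j => {ω | ∀ (l : Fin N) (m : Fin n) (a : Fin (k m)),
    ‖green (H ω) (E m a + y j * Complex.I) l l‖ ≤ (N : ℝ) ^ (2 * ε)} with hgood
  have hgm : ∀ j, MeasurableSet (good j) := fun j => by
    simp only [hgood, Set.ofPred_forall]
    exact MeasurableSet.iInter fun l => MeasurableSet.iInter fun m => MeasurableSet.iInter fun a =>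
      measurableSet_le (measurable_green_apply hHm _ _ _).norm measurable_const
  have hgp : ∀ j ∈ Finset.Icc 1 J, μ.real (good j)ᶜ ≤ ρ := by
    intro j hj
    obtain ⟨i, rfl⟩ : ∃ i, j = i + 1 := ⟨j - 1, by have := (Finset.mem_Icc.1 hj).1; omega⟩
    rw [probReal_compl_eq_one_sub (hgm _)]
    have h1 := hap (y (i + 1)) (by
      rw [hys]
      exact Real.rpow_le_rpow_of_exponent_le hN1 (by
        push_cast
        nlinarith [show (0 : ℝ) ≤ i from Nat.cast_nonneg i]))
    have h2 := h1.trans (measureReal_mono (h₂ := measure_ne_top _ _)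
      (show {ω | ∀ l : Fin N, ∀ E : ℝ, |E| ≤ 2 - κ →
        ‖green (H ω) (E + y (i + 1) * Complex.I) l l‖ ≤ (N : ℝ) ^ (2 * ε)} ⊆ good (i + 1) from
        fun ω hω l m a => hω l (E m a) ((hE m a).trans (by linarith))))
    linarith
  have hsub : largeGreen H z ((N : ℝ) ^ (5 * ε)) ⊆ ⋃ j ∈ Finset.Icc 1 J, (good j)ᶜ := by
    intro ω hω
    by_contra hcon
    simp only [Set.mem_iUnion, Set.mem_compl_iff, not_exists, not_not] at hcon
    obtain ⟨m, a, p, q, hlarge⟩ := hω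
    refine absurd hlarge (not_lt.2 ?_)
    have hchain := norm_green_apply_le_of_chain (hH ω) (x := E m a) (B := (N : ℝ) ^ (2 * ε))
      (q := (N : ℝ) ^ (2 * ε)) (J := J) y (by rw [hy0]; exact hη0) hmono hq hyJ
      (fun j hj1 hjJ l => hcon j (Finset.mem_Icc.2 ⟨hj1, hjJ⟩) l m a) (by positivity)
    have hnum : 1 + J * ((N : ℝ) ^ (2 * ε) * (N : ℝ) ^ (2 * ε)) ≤ (N : ℝ) ^ (5 * ε) := by
      have h4 : (N : ℝ) ^ (2 * ε) * (N : ℝ) ^ (2 * ε) = (N : ℝ) ^ (4 * ε) := by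
        rw [← Real.rpow_add hN0]; congr 1; ring
      have h5 : (N : ℝ) ^ (5 * ε) = (N : ℝ) ^ ε * (N : ℝ) ^ (4 * ε) := by
        rw [← Real.rpow_add hN0]; congr 1; ring
      have h1 : 1 ≤ (N : ℝ) ^ (4 * ε) := Real.one_le_rpow hN1 (by positivity)
      rw [h4, h5]
      calc 1 + J * (N : ℝ) ^ (4 * ε) ≤ (J + 1) * (N : ℝ) ^ (4 * ε) := by linarith
        _ ≤ _ := by gcongr
    rw [hy0] at hchain
    -- in the lower half plane, pass to the adjoint
    refine le_trans ?_ ((hchain _ _).trans hnum) (b := ‖green (H ω) (E m a + η * Complex.I)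
      (if sgn m a = 1 then p else q) (if sgn m a = 1 then q else p)‖)
    rw [hz]
    rcases Int.units_eq_one_or (sgn m a) with h | h
    · rw [h]; simp
    · rw [h, if_neg (by decide), if_neg (by decide), ← norm_green_conj (hH ω)]
      refine le_of_eq (congrArg (fun t => ‖green (H ω) t q p‖) ?_)
      apply Complex.ext <;> simp
  calc μ.real (largeGreen H z ((N : ℝ) ^ (5 * ε)))
      ≤ μ.real (⋃ j ∈ Finset.Icc 1 J, (good j)ᶜ) :=
        measureReal_mono hsub (measure_ne_top _ _)
    _ ≤ ∑ j ∈ Finset.Icc 1 J, μ.real (good j)ᶜ := measureReal_biUnion_finset_le _ _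
    _ ≤ ∑ _j ∈ Finset.Icc 1 J, ρ := Finset.sum_le_sum hgp
    _ = J * ρ := by simp

end Apriori

/-! ### Deterministic bounds for the observable -/

section Deterministic

variable {N n K : ℕ} {k : Fin n → ℕ} {z : (m : Fin n) → Fin (k m) → ℂ} {ε η C₀ : ℝ}
  {F : (Fin n → ℂ) → ℂ} {H : Matrix (Fin N) (Fin N) ℂ}

/-- The arguments of the test function always lie in the region of its polynomial bounds. -/
lemma norm_greenTraces_apply_le_rpow (hN : 1 ≤ N) (hH : H.IsHermitian)
    (hη : (N : ℝ) ^ (-1 - ε) ≤ η) (hz : ∀ m a, |(z m a).im| = η) (m : Fin n) :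
    ‖greenTraces z H m‖ ≤ (N : ℝ) ^ (1 + k m * ε) := by
  have hN0 : (0 : ℝ) < N := by exact_mod_cast hN
  have hη0 : 0 < η := lt_of_lt_of_le (by positivity) hη
  have h := norm_trace_list_prod_green_le hH hη0 (z m) (hz m)
  have hinv : η⁻¹ ≤ (N : ℝ) ^ (1 + ε) := by
    have := inv_anti₀ (by positivity) hη
    rwa [← Real.rpow_neg hN0.le, show -(-1 - ε) = 1 + ε by ring] at this
  rw [greenTraces, norm_mul, norm_inv, norm_pow, Complex.norm_natCast]
  calc ((N : ℝ) ^ k m)⁻¹ * ‖(List.ofFn fun j => green H (z m j)).prod.trace‖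
      ≤ ((N : ℝ) ^ k m)⁻¹ * (N * ((N : ℝ) ^ (1 + ε)) ^ k m) := by
        gcongr
        exact h.trans (by gcongr)
    _ = (N : ℝ) ^ (-(k m : ℝ)) * ((N : ℝ) ^ (1 : ℝ) * (N : ℝ) ^ ((1 + ε) * k m)) := by
        rw [Real.rpow_neg hN0.le, Real.rpow_natCast, Real.rpow_one, Real.rpow_mul hN0.le,
          Real.rpow_natCast]
    _ = _ := by
        rw [← Real.rpow_add hN0, ← Real.rpow_add hN0]; congr 1; ring

/-- The observable deviates from the constant `F 0` by at most a fixed power of `N`, whatever the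
hermitian matrix is. -/
lemma norm_comp_greenTraces_sub_le (hN : 1 ≤ N) (hε : 0 < ε) (hH : H.IsHermitian)
    (hη : (N : ℝ) ^ (-1 - ε) ≤ η) (hz : ∀ m a, |(z m a).im| = η) (hk : ∀ m, 0 < k m)
    (hK : ∑ m, k m = K) (hF : ContDiff ℝ 5 F)
    (hF2 : ∀ x : Fin n → ℂ, (∀ m, ‖x m‖ ≤ (N : ℝ) ^ (max 2 (1 + k m * ε))) →
        PartialsBoundedAt F x ((N : ℝ) ^ C₀)) :
    ‖F (greenTraces z H) - F 0‖ ≤ 2 * K * (N : ℝ) ^ (C₀ + 1 + K * ε) := by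
  have hN1 : (1 : ℝ) ≤ N := by exact_mod_cast hN
  have hN0 : (0 : ℝ) < N := by exact_mod_cast hN
  have hkK : ∀ m, k m ≤ K := fun m => by
    rw [← hK]; exact Finset.single_le_sum (fun _ _ => Nat.zero_le _) (Finset.mem_univ m)
  have hnK : n ≤ K := by
    rw [← hK]
    calc n = ∑ _m : Fin n, 1 := by simp
      _ ≤ _ := Finset.sum_le_sum fun m _ => hk m
  set s : Set (Fin n → ℂ) := {x | ∀ m, ‖x m‖ ≤ (N : ℝ) ^ (max 2 (1 + k m * ε))} with hs
  have hconv : Convex ℝ s := by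
    have : s = Set.univ.pi fun m => Metric.closedBall 0 ((N : ℝ) ^ (max 2 (1 + k m * ε))) := by
      ext x; simp [hs]
    rw [this]
    exact convex_pi fun m _ => convex_closedBall _ _
  have hT := norm_greenTraces_apply_le_rpow hN hH hη hz
  have hmem : greenTraces z H ∈ s := fun m =>
    (hT m).trans (Real.rpow_le_rpow_of_exponent_le hN1 (le_max_right _ _))
  have h0 : (0 : Fin n → ℂ) ∈ s := fun m => by simp; positivity
  have hder : ∀ x ∈ s, ‖fderiv ℝ F x‖ ≤ 2 * n * (N : ℝ) ^ C₀ := by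
    intro x hx
    have h := norm_le_of_coordDir (by positivity) _ (hF2 x hx 1 le_rfl (by norm_num))
    rwa [pow_one, ← norm_iteratedFDeriv_fderiv, norm_iteratedFDeriv_zero] at h
  have h := hconv.norm_image_sub_le_of_norm_fderiv_le (𝕜 := ℝ) (f := F)
    (fun x _ => (hF.differentiable (by norm_num)).differentiableAt) hder h0 hmem
  refine h.trans ?_
  rw [sub_zero]
  have hn : ‖greenTraces z H‖ ≤ (N : ℝ) ^ (1 + K * ε) := by
    refine (pi_norm_le_iff_of_nonneg (by positivity)).2 fun m => (hT m).trans ?_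
    refine Real.rpow_le_rpow_of_exponent_le hN1 ?_
    have : (k m : ℝ) ≤ K := by exact_mod_cast hkK m
    nlinarith
  have hnK' : (n : ℝ) ≤ K := by exact_mod_cast hnK
  calc 2 * n * (N : ℝ) ^ C₀ * ‖greenTraces z H‖ ≤ 2 * K * (N : ℝ) ^ C₀ * (N : ℝ) ^ (1 + K * ε) := by
        gcongr
    _ = _ := by rw [mul_assoc, ← Real.rpow_add hN0]; congr 2; ring

/-- The comparison that uses no randomness at all. -/
lemma norm_integral_sub_le_trivial {Ω : Type*} [MeasurableSpace Ω] {μ : Measure Ω}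
    [IsProbabilityMeasure μ] {f g : Ω → ℂ} (hf : AEStronglyMeasurable f μ)
    (hg : AEStronglyMeasurable g μ) {c₀ : ℂ} {c : ℝ} (hfc : ∀ ω, ‖f ω - c₀‖ ≤ c)
    (hgc : ∀ ω, ‖g ω - c₀‖ ≤ c) : ‖(∫ ω, f ω ∂μ) - ∫ ω, g ω ∂μ‖ ≤ 2 * c := by
  have hi : ∀ h : Ω → ℂ, AEStronglyMeasurable h μ → (∀ ω, ‖h ω - c₀‖ ≤ c) → Integrable h μ := by
    intro h hh hhc
    refine (integrable_const (c + ‖c₀‖)).mono' hh (Filter.Eventually.of_forall fun ω => ?_)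
    have := norm_add_le (h ω - c₀) c₀
    rw [sub_add_cancel] at this
    linarith [hhc ω]
  rw [← integral_sub (hi f hf hfc) (hi g hg hgc)]
  have := norm_integral_le_of_norm_le_const (μ := μ) (f := fun ω => f ω - g ω) (C := 2 * c)
    (Filter.Eventually.of_forall fun ω => by
      have h := norm_sub_le (f ω - c₀) (g ω - c₀)
      rw [sub_sub_sub_cancel_right] at h
      linarith [hfc ω, hgc ω])
  simpa using this

end Deterministic

/-! ### Counting powers of `N` -/

section Powers

/-- The sum over all entries of the bounds for the single replacements, in powers of `x = N`. The
parameters are `Γ = x ^ (5 ε)` for the typical size of resolvent entries, `x ^ ε` for the size of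
the matrix entries, and `r` for the number of additional moments. -/
lemma replacement_sum_le {x ε C₀ A η δ ρ : ℝ} {K r : ℕ} (hx : 1 ≤ x) (hε : 0 < ε) (hε1 : ε ≤ 1)
    (hC₀ : 0 < C₀) (hA : 0 ≤ A) (hD : 240 * (2 * K + 1) ^ 5 * (A + 1) ≤ x ^ ε)
    (hr : 19 + 10 * K + C₀ ≤ r * ε) (hη : x ^ (-1 - ε) ≤ η) (hρ : ρ ≤ x ^ (-(6 + C₀ + K))) :
    x ^ 2 * (24 * ((2 * K + 1) ^ 5 * x ^ (C₀ * (6 * (K + 1) * ε))) *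
        (240 * K * (√x)⁻¹ * (4 * x ^ (5 * ε)) ^ (K + 1)) ^ 4 * x ^ (-δ) +
      2 * (120 * ((2 * K + 1) ^ 5 * x ^ (C₀ * (6 * (K + 1) * ε))) *
          (240 * K * (√x)⁻¹ * (4 * x ^ (5 * ε)) ^ (K + 1)) ^ 5 * (x ^ ε) ^ 5 +
        120 * ((2 * K + 1) ^ 5 * x ^ C₀) *
          (240 * K * (√x)⁻¹ * η⁻¹ ^ (K + 1)) ^ 5 * A / (x ^ ε) ^ r) +
      2 * (2 * K * x ^ (C₀ + 1 + K * ε)) * (ρ + A / (x ^ ε) ^ (5 + r))) ≤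
    4 * x ^ (-(1 / 2) + (6 * (K + 1) * (C₀ + 5) + 11) * ε) +
      x ^ (-δ + (6 * (K + 1) * (C₀ + 5) + 11) * ε) := by
  have hx0 : 0 < x := by linarith
  have mono : ∀ {a b : ℝ}, a ≤ b → x ^ a ≤ x ^ b := fun h =>
    Real.rpow_le_rpow_of_exponent_le hx h
  have hpow : ∀ (a : ℝ) (s : ℕ), (x ^ a) ^ s = x ^ (a * s) := fun a s => by
    rw [Real.rpow_mul hx0.le, Real.rpow_natCast]
  have hK0 : (0 : ℝ) ≤ K := Nat.cast_nonneg K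
  set W : ℝ := (2 * K + 1) ^ 5 with hW
  have hW1 : 1 ≤ W := one_le_pow₀ (by linarith)
  have hWK : (2 : ℝ) * K + 1 ≤ W := le_self_pow₀ (by linarith) (by norm_num)
  set y := x ^ ε with hy
  have hy0 : 0 < y := by positivity
  have hWA : 240 * W * (A + 1) = 240 * W * A + 240 * W := by ring
  have hWA0 : 0 ≤ 240 * W * A := by positivity
  have h240 : 240 * W ≤ y := by linarith
  have h240A : 240 * W * A ≤ y := by linarith
  have hAy0 : A ≤ y := (le_mul_of_one_le_left hA (by linarith)).trans h240A
  have h4 : 4 ≤ y := by linarith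
  have h240K : 240 * (K : ℝ) ≤ y := by linarith
  have hsq : (√x)⁻¹ = x ^ (-(1 / 2) : ℝ) := by
    rw [Real.sqrt_eq_rpow, Real.rpow_neg hx0.le]
  have hη0 : 0 < η := lt_of_lt_of_le (by positivity) hη
  -- the size of one derivative, at the typical and at the worst resolvent
  have hX : 240 * K * (√x)⁻¹ * (4 * x ^ (5 * ε)) ^ (K + 1) ≤
      x ^ (-(1 / 2) + (6 * (K + 1) + 1) * ε) := by
    calc 240 * K * (√x)⁻¹ * (4 * x ^ (5 * ε)) ^ (K + 1)
        ≤ y * (√x)⁻¹ * (y * x ^ (5 * ε)) ^ (K + 1) := by gcongr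
      _ = x ^ (-(1 / 2) + (6 * (K + 1) + 1) * ε) := by
        rw [hsq, hy, ← Real.rpow_add hx0, ← Real.rpow_add hx0, hpow, ← Real.rpow_add hx0]
        congr 1; push_cast; ring
  have hX' : 240 * K * (√x)⁻¹ * η⁻¹ ^ (K + 1) ≤ x ^ (1 + 2 * ((K : ℝ) + 1)) := by
    have h1 : η⁻¹ ≤ x ^ (2 : ℝ) := by
      have := inv_anti₀ (by positivity) hη
      rw [← Real.rpow_neg hx0.le] at this
      exact this.trans (mono (by linarith))
    have h2 : (√x)⁻¹ ≤ 1 := by rw [hsq, ← Real.rpow_zero x]; exact mono (by norm_num)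
    have h3 : y ≤ x ^ (1 : ℝ) := mono hε1
    calc 240 * K * (√x)⁻¹ * η⁻¹ ^ (K + 1) ≤ x ^ (1 : ℝ) * 1 * (x ^ (2 : ℝ)) ^ (K + 1) := by
          gcongr
          linarith
      _ = _ := by
        rw [mul_one, hpow, ← Real.rpow_add hx0]; congr 1; push_cast; ring
  set X := 240 * K * (√x)⁻¹ * (4 * x ^ (5 * ε)) ^ (K + 1)
  set X' := 240 * K * (√x)⁻¹ * η⁻¹ ^ (K + 1)
  have hX0 : 0 ≤ X := by positivity
  have hX0' : 0 ≤ X' := by positivity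
  have hx2 : x ^ 2 = x ^ (2 : ℝ) := by norm_cast
  set c₁ : ℝ := 6 * (K + 1) * (C₀ + 5) + 11 with hc₁
  have hc₁' : c₁ = C₀ * (6 * (K + 1)) + 30 * (K + 1) + 11 := by rw [hc₁]; ring
  have t1 : x ^ 2 * (24 * (W * x ^ (C₀ * (6 * (K + 1) * ε))) * X ^ 4 * x ^ (-δ)) ≤
      x ^ (-δ + c₁ * ε) := by
    calc _ = x ^ 2 * ((24 * W) * x ^ (C₀ * (6 * (K + 1) * ε)) * X ^ 4 * x ^ (-δ)) := by ring
      _ ≤ x ^ 2 * (y * x ^ (C₀ * (6 * (K + 1) * ε)) *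
          (x ^ (-(1 / 2) + (6 * (K + 1) + 1) * ε)) ^ 4 * x ^ (-δ)) := by
          gcongr
          linarith
      _ = x ^ (-δ + (C₀ * (6 * (K + 1)) + 24 * (K + 1) + 5) * ε) := by
          rw [hx2, hpow, hy, ← Real.rpow_add hx0, ← Real.rpow_add hx0, ← Real.rpow_add hx0,
            ← Real.rpow_add hx0]
          congr 1; push_cast; ring
      _ ≤ _ := mono (by
          have : (C₀ * (6 * (K + 1)) + 24 * (K + 1) + 5) * ε ≤ c₁ * ε := by
            rw [hc₁']; gcongr <;> norm_num
          linarith)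
  have t2 : x ^ 2 * (2 * (120 * (W * x ^ (C₀ * (6 * (K + 1) * ε))) * X ^ 5 * y ^ 5)) ≤
      x ^ (-(1 / 2) + c₁ * ε) := by
    calc _ = x ^ 2 * ((240 * W) * x ^ (C₀ * (6 * (K + 1) * ε)) * X ^ 5 * y ^ 5) := by ring
      _ ≤ x ^ 2 * (y * x ^ (C₀ * (6 * (K + 1) * ε)) *
          (x ^ (-(1 / 2) + (6 * (K + 1) + 1) * ε)) ^ 5 * y ^ 5) := by gcongr
      _ = x ^ (-(1 / 2) + (C₀ * (6 * (K + 1)) + 30 * (K + 1) + 11) * ε) := by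
          rw [hx2, hpow, hy, hpow, ← Real.rpow_add hx0, ← Real.rpow_add hx0, ← Real.rpow_add hx0,
            ← Real.rpow_add hx0]
          congr 1; push_cast; ring
      _ ≤ _ := by rw [hc₁']
  have hhalf : x ^ (-(1 / 2) : ℝ) ≤ x ^ (-(1 / 2) + c₁ * ε) :=
    mono (le_add_of_nonneg_right (by positivity))
  have t3 : x ^ 2 * (2 * (120 * (W * x ^ C₀) * X' ^ 5 * A / y ^ r)) ≤
      x ^ (-(1 / 2) + c₁ * ε) := by
    have h3 : y ≤ x ^ (1 : ℝ) := mono hε1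
    refine le_trans ?_ hhalf
    calc _ = x ^ 2 * ((240 * W * A) * x ^ C₀ * X' ^ 5 * (y ^ r)⁻¹) := by ring
      _ ≤ x ^ 2 * (x ^ (1 : ℝ) * x ^ C₀ * (x ^ (1 + 2 * ((K : ℝ) + 1))) ^ 5 * (y ^ r)⁻¹) := by
          gcongr
          linarith
      _ = x ^ (18 + 10 * K + C₀ - r * ε) := by
          rw [hx2, hpow, hy, hpow, ← Real.rpow_neg hx0.le, ← Real.rpow_add hx0,
            ← Real.rpow_add hx0, ← Real.rpow_add hx0, ← Real.rpow_add hx0]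
          congr 1; push_cast; ring
      _ ≤ _ := mono (by linarith)
  have hc : 4 * K * x ^ (C₀ + 1 + K * ε) ≤ x ^ (C₀ + 2 + K) := by
    calc 4 * K * x ^ (C₀ + 1 + K * ε) ≤ x ^ (1 : ℝ) * x ^ (C₀ + 1 + K) := by
          have h3 : y ≤ x ^ (1 : ℝ) := mono hε1
          gcongr
          · linarith
          · exact mul_le_of_le_one_right hK0 hε1
      _ = _ := by rw [← Real.rpow_add hx0]; congr 1; ring
  have t4 : x ^ 2 * (2 * (2 * K * x ^ (C₀ + 1 + K * ε)) * ρ) ≤ x ^ (-(1 / 2) + c₁ * ε) := by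
    refine le_trans ?_ hhalf
    calc _ = x ^ 2 * ((4 * K * x ^ (C₀ + 1 + K * ε)) * ρ) := by ring
      _ ≤ x ^ 2 * ((4 * K * x ^ (C₀ + 1 + K * ε)) * x ^ (-(6 + C₀ + K))) := by gcongr
      _ ≤ x ^ 2 * (x ^ (C₀ + 2 + K) * x ^ (-(6 + C₀ + K))) := by gcongr
      _ = x ^ (-2 : ℝ) := by
          rw [hx2, ← Real.rpow_add hx0, ← Real.rpow_add hx0]; congr 1; ring
      _ ≤ _ := mono (by norm_num)
  have t5 : x ^ 2 * (2 * (2 * K * x ^ (C₀ + 1 + K * ε)) * (A / y ^ (5 + r))) ≤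
      x ^ (-(1 / 2) + c₁ * ε) := by
    refine le_trans ?_ hhalf
    have hAy : A ≤ x ^ (1 : ℝ) := hAy0.trans (mono hε1)
    calc _ = x ^ 2 * ((4 * K * x ^ (C₀ + 1 + K * ε)) * (A * (y ^ (5 + r))⁻¹)) := by ring
      _ ≤ x ^ 2 * (x ^ (C₀ + 2 + K) * (x ^ (1 : ℝ) * (y ^ (5 + r))⁻¹)) := by gcongr
      _ = x ^ (5 + C₀ + K - (5 + r) * ε) := by
          rw [hx2, hy, hpow, ← Real.rpow_neg hx0.le, ← Real.rpow_add hx0, ← Real.rpow_add hx0,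
            ← Real.rpow_add hx0]
          congr 1; push_cast; ring
      _ ≤ _ := mono (by linarith)
  calc _ = x ^ 2 * (24 * (W * x ^ (C₀ * (6 * (K + 1) * ε))) * X ^ 4 * x ^ (-δ)) +
        x ^ 2 * (2 * (120 * (W * x ^ (C₀ * (6 * (K + 1) * ε))) * X ^ 5 * y ^ 5)) +
        x ^ 2 * (2 * (120 * (W * x ^ C₀) * X' ^ 5 * A / y ^ r)) +
        x ^ 2 * (2 * (2 * K * x ^ (C₀ + 1 + K * ε)) * ρ) +
        x ^ 2 * (2 * (2 * K * x ^ (C₀ + 1 + K * ε)) * (A / y ^ (5 + r))) := by ring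
    _ ≤ _ := by linarith

lemma eventually_le_natCast_rpow (c : ℝ) {ε : ℝ} (hε : 0 < ε) :
    ∀ᶠ N : ℕ in Filter.atTop, c ≤ (N : ℝ) ^ ε :=
  ((tendsto_rpow_atTop hε).comp tendsto_natCast_atTop_atTop).eventually_ge_atTop c

/-- The exceptional probability `N ^ (-c log log N)` beats every power of `N`. -/
lemma eventually_mul_rpow_loglog_le (c : ℝ) {c' : ℝ} (hc' : 0 < c') (s : ℝ) :
    ∀ᶠ N : ℕ in Filter.atTop,
      c * (N : ℝ) ^ (-c' * Real.log (Real.log N)) ≤ (N : ℝ) ^ (-s) := by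
  have hll : Filter.Tendsto (fun N : ℕ => c' * Real.log (Real.log N)) Filter.atTop Filter.atTop :=
    (Real.tendsto_log_atTop.comp (Real.tendsto_log_atTop.comp
      tendsto_natCast_atTop_atTop)).const_mul_atTop hc'
  filter_upwards [hll.eventually_ge_atTop (s + 1), eventually_le_natCast_rpow c one_pos,
    Filter.eventually_ge_atTop 1] with N h1 h2 h3
  have hN1 : (1 : ℝ) ≤ N := by exact_mod_cast h3
  have hN0 : (0 : ℝ) < N := by linarith
  calc c * (N : ℝ) ^ (-c' * Real.log (Real.log N))
      ≤ (N : ℝ) ^ (1 : ℝ) * (N : ℝ) ^ (-(s + 1)) := by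
        gcongr
        linarith
    _ = _ := by rw [← Real.rpow_add hN0]; congr 1; ring

/-- Chebyshev's inequality for the moment of order `q`. -/
lemma measureReal_lt_norm_le {Ω : Type*} [MeasurableSpace Ω] {μ : Measure Ω} {X : Ω → ℂ} {q : ℕ}
    [IsProbabilityMeasure μ] (hX : Integrable (fun ω => ‖X ω‖ ^ q) μ) {R A : ℝ} (hR : 0 < R)
    (hA : ∫ ω, ‖X ω‖ ^ q ∂μ ≤ A) : μ.real {ω | R < ‖X ω‖} ≤ A / R ^ q := by
  have h := mul_meas_ge_le_integral_of_nonneg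
    (Filter.Eventually.of_forall fun ω => by positivity) hX (R ^ q)
  rw [le_div_iff₀' (by positivity)]
  refine le_trans ?_ (h.trans hA)
  exact mul_le_mul_of_nonneg_left (measureReal_mono (fun ω (hω : R < ‖X ω‖) =>
    pow_le_pow_left₀ hR.le hω.le q) (measure_ne_top _ _)) (by positivity)

end Powers

end GreenComparison

/-! ### The comparison theorem -/

set_option maxHeartbeats 1000000 in
theorem theorem4p1 :
    ∀ (ϑ : ℝ) (_ : 0 < ϑ) (K : ℕ) (C₀ : ℝ) (_ : 0 < C₀),
    -- `C₁` depends on `ϑ`, `∑ k_m` and `C₀` only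
    ∃ C₁ : ℝ, 0 < C₁ ∧
    -- `ε₀` is the threshold in "for all sufficiently small `ε'`"
    ∀ (ε₀ : ℝ) (_ : 0 < ε₀),
    ∃ C₂ : ℝ, 0 < C₂ ∧
    ∀ (C Cinf Csup κ δ ε : ℝ) (_ : 0 < C) (_ : 0 < Cinf) (_ : 0 < Csup) (_ : 0 < κ) (_ : 0 < δ)
      (_ : 0 < ε) (Cb cb : ℝ → ℝ) (_ : ∀ τ, 0 < τ → 0 < cb τ) (N₁ : ℝ → ℕ),
    ∃ N₀ : ℕ, ∀ N : ℕ, N₀ ≤ N →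
    ∀ (Ω : Type*) [MeasurableSpace Ω] (μ : Measure Ω) [IsProbabilityMeasure μ]
      (v w : Ω → Matrix (Fin N) (Fin N) ℂ)
      -- the two generalized Wigner matrices
      (_ : IsGeneralizedWigner μ Cinf Csup fun ω => normalized (v ω))
      (_ : IsGeneralizedWigner μ Cinf Csup fun ω => normalized (w ω))
      (_ : SubexpDecay μ C ϑ v) (_ : SubexpDecay μ C ϑ w)
      -- the pairs `(v_ij, w_ij)`, `i ≤ j`, are independent
      (_ : iIndepFun (fun (p : UpperIdx N) ω => (v ω p.1.1 p.1.2, w ω p.1.1 p.1.2)) μ)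
      (φ : UpperIdx N ≃ Finset.Icc 1 (N * (N + 1) / 2))
      -- a priori bound on the diagonal of the resolvents of all interpolating matrices
      (_ : ∀ τ : ℝ, 0 < τ → ∀ y : ℝ, (N : ℝ) ^ (-1 + τ) ≤ y →
        1 - Cb τ * (N : ℝ) ^ (-(cb τ) * Real.log (Real.log N)) ≤
          μ.real {ω | ∀ γ ≤ N * (N + 1) / 2, ∀ l : Fin N, ∀ E : ℝ, |E| ≤ 2 - κ →
            ‖green (interpolate φ γ (normalized (v ω)) (normalized (w ω)))
              (E + y * Complex.I) l l‖ ≤ (N : ℝ) ^ (2 * τ)})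
      -- moment matching
      (_ : ∀ i j, ∀ s u : ℕ, s + u ≤ 3 → entryMoment μ v i j s u = entryMoment μ w i j s u)
      (_ : ∀ i j, ∀ s : ℕ, s ≤ 4 →
        ‖entryMoment μ v i j s (4 - s) - entryMoment μ w i j s (4 - s)‖ ≤ (N : ℝ) ^ (-δ))
      -- spectral parameters
      (η : ℝ) (_ : (N : ℝ) ^ (-1 - ε) ≤ η) (_ : η ≤ (N : ℝ) ^ (-1 : ℝ))
      (n : ℕ) (k : Fin n → ℕ) (_ : ∀ m, 0 < k m) (_ : ∑ m, k m = K)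
      (E : (m : Fin n) → Fin (k m) → ℝ) (_ : ∀ m j, |E m j| ≤ 2 - 2 * κ)
      (sgn : (m : Fin n) → Fin (k m) → ℤˣ)
      (z : (m : Fin n) → Fin (k m) → ℂ)
      (_ : ∀ m j, z m j = E m j + ((sgn m j : ℤ) : ℂ) * η * Complex.I)
      -- the test function
      (F : (Fin n → ℂ) → ℂ) (_ : ContDiff ℝ 5 F)
      (_ : ∀ ε' : ℝ, 0 < ε' → ε' ≤ ε₀ → N₁ ε' ≤ N → ∀ x : Fin n → ℂ,
        (∀ m, ‖x m‖ ≤ (N : ℝ) ^ ε') → PartialsBoundedAt F x ((N : ℝ) ^ (C₀ * ε')))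
      (_ : ∀ x : Fin n → ℂ, (∀ m, ‖x m‖ ≤ (N : ℝ) ^ (max 2 (1 + k m * ε))) →
        PartialsBoundedAt F x ((N : ℝ) ^ C₀)),
    (C₁ * ε ≤ ε₀ →
      ‖(∫ ω, F (greenTraces z (normalized (v ω))) ∂μ) -
        (∫ ω, F (greenTraces z (normalized (w ω))) ∂μ)‖ ≤
        C₁ * (N : ℝ) ^ (-(1 / 2) + C₁ * ε) + C₁ * (N : ℝ) ^ (-δ + C₁ * ε)) ∧
    ‖(∫ ω, F (greenTraces z (normalized (v ω))) ∂μ) -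
      (∫ ω, F (greenTraces z (normalized (w ω))) ∂μ)‖ ≤
      C₂ * (N : ℝ) ^ (-(1 / 2) + C₂ * ε) + C₂ * (N : ℝ) ^ (-δ + C₂ * ε) := by
  intro ϑ hϑ K C₀ hC₀
  -- `c₁ * ε` is the loss in the exponent from the replacements; the further summands of `C₁` make
  -- up for the deterministic bound when `ε ≥ 1 / 24`, those of `C₂` when `ε > ε₀ / C₁`.
  set c₁ : ℝ := 6 * (K + 1) * (C₀ + 5) + 11 with hc₁
  set C₁ : ℝ := c₁ + 4 * K + 24 * (C₀ + 2) with hC₁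
  have hK0 : (0 : ℝ) ≤ K := Nat.cast_nonneg K
  have hc₁5 : 11 ≤ c₁ := by rw [hc₁]; linarith [show 0 ≤ 6 * ((K : ℝ) + 1) * (C₀ + 5) by positivity]
  have hC₁0 : 0 < C₁ := by positivity
  refine ⟨C₁, hC₁0, fun ε₀ hε₀ => ?_⟩
  set C₂ : ℝ := C₁ + K + (C₀ + 2) * C₁ / ε₀ with hC₂
  have hC₁₂ : C₁ ≤ C₂ := by
    have : 0 ≤ (C₀ + 2) * C₁ / ε₀ := by positivity
    linarith
  have hC₂0 : 0 < C₂ := by linarith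
  refine ⟨C₂, hC₂0, fun C Cinf Csup κ δ ε hC _ _ hκ hδ hε Cb cb hcb N₁ => ?_⟩
  -- `J` heights reach from `η` to order one, and `r` additional moments make the tails of the
  -- entries negligible
  obtain ⟨J, hJ⟩ := exists_nat_ge (1 / ε)
  have hJ1 : 1 ≤ J * ε := by rwa [div_le_iff₀ hε] at hJ
  obtain ⟨r, hr⟩ := exists_nat_ge ((19 + 10 * K + C₀) / ε)
  have hr1 : 19 + 10 * K + C₀ ≤ r * ε := by rwa [div_le_iff₀ hε] at hr
  choose A' hA' using fun q => GreenComparison.exists_moment_bound.{u_1} C hC hϑ q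
  set A : ℝ := max 0 (A' (5 + r)) with hA
  have hA0 : 0 ≤ A := le_max_left _ _
  -- `N ^ ε'` dominates the traces when the resolvent entries are at most `4 * N ^ (5 * ε)`
  set ε' : ℝ := 6 * (K + 1) * ε with hε'
  have hε'0 : 0 < ε' := by positivity
  obtain ⟨N₀, hN₀⟩ := Filter.eventually_atTop.1
    ((GreenComparison.eventually_le_natCast_rpow (J + 1) hε).and
      ((GreenComparison.eventually_le_natCast_rpow (240 * (2 * K + 1) ^ 5 * (A + 1)) hε).and
        ((GreenComparison.eventually_mul_rpow_loglog_le (J * Cb ε) (hcb ε hε)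
          (6 + C₀ + K)).and
          ((Filter.eventually_ge_atTop 1).and (Filter.eventually_ge_atTop (N₁ ε'))))))
  refine ⟨N₀, fun N hN Ω _ μ _ v w hv hw hvd hwd hind φ hap hm3 hm4 η hη1 hη2 n k hk hK E hE sgn z
    hz F hF hF1 hF2 => ?_⟩
  obtain ⟨hJN, hDN, hρN, hN1, hN₁⟩ := hN₀ N hN
  have hx1 : (1 : ℝ) ≤ N := by exact_mod_cast hN1
  have hx0 : (0 : ℝ) < N := by linarith
  have mono : ∀ {a b : ℝ}, a ≤ b → (N : ℝ) ^ a ≤ (N : ℝ) ^ b := fun h =>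
    Real.rpow_le_rpow_of_exponent_le hx1 h
  have hη0 : 0 < η := lt_of_lt_of_le (by positivity) hη1
  have hη1' : η ≤ 1 := hη2.trans (by rw [← Real.rpow_zero (N : ℝ)]; exact mono (by norm_num))
  have hzη : ∀ m a, |(z m a).im| = η := fun m a =>
    GreenComparison.abs_im_eq hη0 (sgn m a) (hz m a)
  have hsN : ((√(N : ℝ))⁻¹ : ℂ) ≠ 0 := by
    have : √(N : ℝ) ≠ 0 := (Real.sqrt_pos.2 hx0).ne'
    exact_mod_cast inv_ne_zero this
  have hmeas : ∀ {u : Ω → Matrix (Fin N) (Fin N) ℂ},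
      IsGeneralizedWigner μ Cinf Csup (fun ω => normalized (u ω)) →
      ∀ a b, Measurable fun ω => u ω a b := by
    intro u hu a b
    have h := (hu.measurable a b).const_mul (((√(N : ℝ))⁻¹ : ℂ)⁻¹)
    have e : (fun ω => u ω a b) = fun ω => ((√(N : ℝ))⁻¹ : ℂ)⁻¹ * normalized (u ω) a b := by
      funext ω
      rw [GreenComparison.normalized_apply]
      push_cast
      rw [← mul_assoc, inv_mul_cancel₀ hsN, one_mul]
    rw [e]
    exact h
  have hvm := hmeas hv
  have hwm := hmeas hw
  have hc : ∀ H : Matrix (Fin N) (Fin N) ℂ, H.IsHermitian →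
      ‖F (greenTraces z H) - F 0‖ ≤ 2 * K * (N : ℝ) ^ (C₀ + 1 + K * ε) := fun H hH =>
    GreenComparison.norm_comp_greenTraces_sub_le hN1 hε hH hη1 hzη hk hK hF hF2
  have hmF : ∀ {u : Ω → Matrix (Fin N) (Fin N) ℂ}, (∀ a b, Measurable fun ω => normalized (u ω) a b) →
      AEStronglyMeasurable (fun ω => F (greenTraces z (normalized (u ω)))) μ := fun hu =>
    (hF.continuous.measurable.comp
      (GreenComparison.measurable_greenTraces z hu)).aestronglyMeasurable
  -- a power `N ^ (D * ε)` that beats the deterministic bound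
  have htriv : ∀ D : ℝ, 4 * K ≤ D → C₀ + 2 + K * ε ≤ D * ε →
      ‖(∫ ω, F (greenTraces z (normalized (v ω))) ∂μ) -
        (∫ ω, F (greenTraces z (normalized (w ω))) ∂μ)‖ ≤
        D * (N : ℝ) ^ (-(1 / 2) + D * ε) + D * (N : ℝ) ^ (-δ + D * ε) := by
    intro D hD1 hD2
    have hD0 : 0 ≤ D := le_trans (by positivity) hD1
    have h := GreenComparison.norm_integral_sub_le_trivial (μ := μ) (hmF hv.measurable)
      (hmF hw.measurable) (fun ω => hc _ (hv.hermitian ω)) (fun ω => hc _ (hw.hermitian ω))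
    have h2 : 0 ≤ D * (N : ℝ) ^ (-δ + D * ε) := by positivity
    have h3 : 4 * K * (N : ℝ) ^ (C₀ + 1 + K * ε) ≤ D * (N : ℝ) ^ (-(1 / 2) + D * ε) :=
      mul_le_mul hD1 (mono (by linarith)) (by positivity) hD0
    linarith
  have hmain : C₁ * ε ≤ ε₀ → ‖(∫ ω, F (greenTraces z (normalized (v ω))) ∂μ) -
        (∫ ω, F (greenTraces z (normalized (w ω))) ∂μ)‖ ≤
        C₁ * (N : ℝ) ^ (-(1 / 2) + C₁ * ε) + C₁ * (N : ℝ) ^ (-δ + C₁ * ε) := by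
    intro hCε
    rcases le_or_gt (1 / 24) ε with hε24 | hε24
    · refine htriv C₁ (by linarith) ?_
      have h1 : C₀ + 2 ≤ 24 * (C₀ + 2) * ε := by nlinarith
      have h2 : 0 ≤ c₁ * ε := by positivity
      have h3 : 0 ≤ 3 * (K * ε) := by positivity
      calc C₀ + 2 + K * ε ≤ 24 * (C₀ + 2) * ε + K * ε + c₁ * ε + 3 * (K * ε) := by linarith
        _ = C₁ * ε := by rw [hC₁]; ring
    have hε'₀ : ε' ≤ ε₀ := by
      refine le_trans ?_ hCε
      have h1 : 6 * ((K : ℝ) + 1) ≤ c₁ := by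
        rw [hc₁]
        nlinarith [show 0 ≤ ((K : ℝ) + 1) * (C₀ + 4) by positivity]
      rw [hε']
      gcongr
      linarith
    have h8 : 240 ≤ (N : ℝ) ^ ε := by
      have h1 : (1 : ℝ) ≤ (2 * K + 1) ^ 5 := one_le_pow₀ (by linarith)
      have h2 : (1 : ℝ) * 1 ≤ (2 * K + 1) ^ 5 * (A + 1) := by gcongr; linarith
      linarith
    have hpow : ∀ (a : ℝ) (s : ℕ), ((N : ℝ) ^ a) ^ s = (N : ℝ) ^ (a * s) := fun a s => by
      rw [Real.rpow_mul hx0.le, Real.rpow_natCast]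
    have hmom : ∀ {u : Ω → Matrix (Fin N) (Fin N) ℂ}, (∀ a b, Measurable fun ω => u ω a b) →
        SubexpDecay μ C ϑ u → ∀ a b, ∀ q : ℕ, Integrable (fun ω => ‖u ω a b‖ ^ q) μ ∧
          ∫ ω, ‖u ω a b‖ ^ q ∂μ ≤ A' q := fun hum hud a b q =>
      hA' q Ω μ (fun ω => _) (hum a b) (hud a b)
    have hsmall : 8 * (√(N : ℝ))⁻¹ * (N : ℝ) ^ ε * (N : ℝ) ^ (5 * ε) ≤ 1 := by
      calc 8 * (√(N : ℝ))⁻¹ * (N : ℝ) ^ ε * (N : ℝ) ^ (5 * ε)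
          ≤ (N : ℝ) ^ ε * (N : ℝ) ^ (-(1 / 2) : ℝ) * (N : ℝ) ^ ε * (N : ℝ) ^ (5 * ε) := by
            rw [Real.sqrt_eq_rpow, Real.rpow_neg hx0.le]
            gcongr
            linarith
        _ = (N : ℝ) ^ (-(1 / 2) + 7 * ε) := by
            rw [← Real.rpow_add hx0, ← Real.rpow_add hx0, ← Real.rpow_add hx0]
            congr 1; ring
        _ ≤ 1 := Real.rpow_le_one_of_one_le_of_nonpos hx1 (by linarith)
    have hB : ∀ y : Fin n → ℂ, (∀ s, ‖y s‖ ≤ (4 * (N : ℝ) ^ (5 * ε)) ^ k s) →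
        PartialsBoundedAt F y ((N : ℝ) ^ (C₀ * ε')) := by
      refine fun y hy => hF1 ε' hε'0 hε'₀ hN₁ y fun s => (hy s).trans ?_
      have hks : k s ≤ K := by
        rw [← hK]; exact Finset.single_le_sum (fun _ _ => Nat.zero_le _) (Finset.mem_univ s)
      have hks' : (k s : ℝ) ≤ K := by exact_mod_cast hks
      calc (4 * (N : ℝ) ^ (5 * ε)) ^ k s ≤ ((N : ℝ) ^ ε * (N : ℝ) ^ (5 * ε)) ^ k s := by
            gcongr
            linarith
        _ = (N : ℝ) ^ (6 * ε * k s) := by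
            rw [← Real.rpow_add hx0, hpow]; congr 1; ring
        _ ≤ _ := mono (by rw [hε']; nlinarith)
    have hB' : ∀ H : Matrix (Fin N) (Fin N) ℂ, H.IsHermitian →
        PartialsBoundedAt F (greenTraces z H) ((N : ℝ) ^ C₀) := fun H hH => hF2 _ fun s =>
      (GreenComparison.norm_greenTraces_apply_le_rpow hN1 hH hη1 hzη s).trans
        (mono (le_max_right _ _))
    have hlarge : ∀ γ < N * (N + 1) / 2,
        μ.real (GreenComparison.largeGreen (fun ω => interpolate φ (γ + 1) (normalized (v ω))
          (normalized (w ω))) z ((N : ℝ) ^ (5 * ε))) ≤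
        J * (Cb ε * (N : ℝ) ^ (-(cb ε) * Real.log (Real.log N))) := fun γ hγ =>
      GreenComparison.measureReal_largeGreen_le hN1
        (GreenComparison.measurable_interpolate hvm hwm _)
        (fun ω => GreenComparison.isHermitian_interpolate φ _ (hv.hermitian ω) (hw.hermitian ω))
        hε hκ (fun y hy => (hap ε hε y hy).trans (measureReal_mono
          (fun ω hω l E hEκ => hω (γ + 1) hγ l E hEκ) (measure_ne_top _ _)))
        hη1 hη2 hE hz hJ1 hJN
    have hstep := fun (γ : ℕ) (hγ : γ < N * (N + 1) / 2) =>
      GreenComparison.norm_integral_interpolate_succ_sub_le (μ := μ) (φ := φ) hγ hvm hwm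
        hv.hermitian hw.hermitian hind hk hK hη0 hη1' hzη hF (by positivity)
        (Real.one_le_rpow hx1 (by positivity)) hsmall (by positivity) (by positivity) hB hB' hc
        (r := r) (A := A) (δ' := A / ((N : ℝ) ^ ε) ^ (5 + r))
        (fun a b q => (hmom hvm hvd a b q).1) (fun a b q => (hmom hwm hwd a b q).1)
        (fun a b => (hmom hvm hvd a b _).2.trans (le_max_right _ _))
        (fun a b => (hmom hwm hwd a b _).2.trans (le_max_right _ _)) hm3 hm4 (hlarge γ hγ)
        (fun a b => GreenComparison.measureReal_lt_norm_le (hmom hwm hwd a b (5 + r)).1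
          (by positivity) ((hmom hwm hwd a b _).2.trans (le_max_right _ _)))
    have hN0' : 0 < N * (N + 1) / 2 := by
      refine Nat.div_pos ?_ two_pos
      nlinarith
    have h := GreenComparison.norm_integral_sub_le_card_mul
      (h := fun H => F (greenTraces z H)) hstep ((norm_nonneg _).trans (hstep 0 hN0'))
    refine h.trans ((GreenComparison.replacement_sum_le hx1 hε (by linarith) hC₀ hA0 hDN hr1 hη1
      (by rw [← mul_assoc]; exact hρN)).trans ?_)
    have hcC : c₁ * ε ≤ C₁ * ε := by
      gcongr
      linarith
    have h4 : 4 ≤ C₁ := by linarith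
    have h5 : 1 ≤ C₁ := by linarith
    refine add_le_add ?_ ?_
    · exact mul_le_mul h4 (mono (by linarith)) (by positivity) hC₁0.le
    · calc (N : ℝ) ^ (-δ + c₁ * ε) ≤ (N : ℝ) ^ (-δ + C₁ * ε) := mono (by linarith)
        _ ≤ _ := le_mul_of_one_le_left (by positivity) h5
  refine ⟨hmain, ?_⟩
  rcases le_or_gt (C₁ * ε) ε₀ with hCε | hCε
  · refine (hmain hCε).trans ?_
    have : C₁ * ε ≤ C₂ * ε := by gcongr
    exact add_le_add (mul_le_mul hC₁₂ (mono (by linarith)) (by positivity) hC₂0.le)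
      (mul_le_mul hC₁₂ (mono (by linarith)) (by positivity) hC₂0.le)
  · refine htriv C₂ (by linarith) ?_
    have h1 : 1 ≤ C₁ / ε₀ * ε := by
      rw [div_mul_eq_mul_div, one_le_div hε₀]; exact hCε.le
    have h2 : 0 ≤ C₁ * ε := by positivity
    have h3 : (C₀ + 2) * 1 ≤ (C₀ + 2) * (C₁ / ε₀ * ε) := by gcongr
    calc C₀ + 2 + K * ε ≤ C₁ * ε + K * ε + (C₀ + 2) * (C₁ / ε₀ * ε) := by linarith
      _ = C₂ * ε := by rw [hC₂]; ring
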